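/- Let $\mathbb{F}_4$ be the field with four elements, with conjugation $\overline{\alpha}=\alpha^2$. A quaternary $[m,k,d]$ code is a $k$-dimensional subspace $C$ of $\mathbb{F}_4^m$ whose minimum weight, i.e. the least number of nonzero coordinates of a nonzero vector of $C$, equals $d$. It is Hermitian LCD (linear complementary dual) if $C\cap C^{\perp_H}=\{0\}$, where $C^{\perp_H}=\{x\in\mathbb{F}_4^m : \sum_{i=1}^m x_i\overline{y_i}=0 \text{ for all } y\in C\}$. Let $$\mathcal{P}'_4=\left\{\begin{array}{l} (21,8,9),(21,10,8),(21,11,7),(22,8,10),(23,18,4),(24,16,6),(25,18,4),\\ (25,19,4),(26,16,6),(26,17,6),(26,20,4),(26,21,4),(27,21,4),(27,22,4),\\ (28,21,4),(28,22,4),(28,23,4),(29,22,4),(29,23,4),(30,23,4),(30,24,4) \end{array}\right\}.$$ For every $(n,k,d)\in\mathcal{P}'_4$ and every integer $s\ge 0$, there is a quaternary Hermitian LCD $\left[n+\frac{4^k-1}{3}s,\;k,\;d+4^{k-1}s\right]$ code. -/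

import Mathlib

namespace QuaternaryLCD

/-- The Hermitian inner product `∑ xᵢ ȳᵢ`, with `ȳ = y ^ q`, on vectors over a field of
order `q ^ 2`. -/
def hermInner {F : Type*} [Field F] (q : ℕ) {n : ℕ} (x y : Fin n → F) : F :=
  ∑ i, x i * y i ^ q

/-- The Hermitian dual code: all `x` with `hermInner q x y = 0` for every `y ∈ C`. -/
def hermDual {F : Type*} [Field F] (q : ℕ) {n : ℕ} (C : Submodule F (Fin n → F)) :
    Submodule F (Fin n → F) where
  carrier := {x | ∀ y ∈ C, hermInner q x y = 0}
  zero_mem' := fun y _ => by simp [hermInner]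
  add_mem' := fun {a b} ha hb y hy => by
    have h1 := ha y hy
    have h2 := hb y hy
    simp only [hermInner] at h1 h2 ⊢
    simp only [Pi.add_apply, add_mul, Finset.sum_add_distrib, h1, h2, add_zero]
  smul_mem' := fun c a ha y hy => by
    have h1 := ha y hy
    simp only [hermInner] at h1 ⊢
    simp only [Pi.smul_apply, smul_eq_mul, mul_assoc, ← Finset.mul_sum, h1, mul_zero]

/-- A code over a field of order `q ^ 2` is Hermitian linear complementary dual if it meets its
Hermitian dual only in the zero vector. -/
def IsHermitianLCD {F : Type*} [Field F] (q : ℕ) {n : ℕ} (C : Submodule F (Fin n → F)) : Prop :=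
  C ⊓ hermDual q C = ⊥

/-- `C` has minimum weight `d`: `d` is the least weight of a nonzero codeword. -/
def HasMinWeight {F : Type*} [Field F] [DecidableEq F] {n : ℕ} (C : Submodule F (Fin n → F))
    (d : ℕ) : Prop :=
  IsLeast {w : ℕ | ∃ x ∈ C, x ≠ 0 ∧ hammingNorm x = w} d

/-- `C ⊆ F ^ n` is an `[n, k, d]` code: it has dimension `k` and minimum weight exactly `d`. -/
def IsCode {F : Type*} [Field F] [DecidableEq F] (n k d : ℕ) (C : Submodule F (Fin n → F)) :
    Prop :=
  Module.finrank F C = k ∧ HasMinWeight C d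

/-- The list of 21 parameter triples `(n, k, d)`. -/
def paramSet : Set (ℕ × ℕ × ℕ) :=
  {(21, 8, 9), (21, 10, 8), (21, 11, 7), (22, 8, 10), (23, 18, 4),
   (24, 16, 6), (25, 18, 4), (25, 19, 4), (26, 16, 6), (26, 17, 6),
   (26, 20, 4), (26, 21, 4), (27, 21, 4), (27, 22, 4), (28, 21, 4),
   (28, 22, 4), (28, 23, 4), (29, 22, 4), (29, 23, 4), (30, 23, 4),
   (30, 24, 4)}

end QuaternaryLCD

/-! Let `V` be a code of dimension `k ≥ 2` over the field of four elements. Evaluating one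
functional from each point of the projective space of the dual of `V` embeds `V` as a simplex code:
all its nonzero words have the weight `4 ^ (k - 1)`, and it is Hermitian self-orthogonal by a
Chevalley–Warning count. Juxtaposing a Hermitian LCD code with its simplex code therefore adds
`4 ^ (k - 1)` to all nonzero weights and leaves the Hermitian products unchanged, so the result is
again Hermitian LCD, and this can be repeated `s` times.

That leaves one code for each of the 21 parameter triples. The span of a Hermitian orthonormal basis
is LCD, and its minimum weight is verified by the Brouwer–Zimmermann method: if no position lies in
more than `m` of `r` information sets, a word of weight less than `d` has at most `b` nonzero
entries on one of them, where `m * (d - 1) < r * (b + 1)`, so it suffices to enumerate the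
combinations of at most `b` rows of the systematic generator matrices. -/

open Finset
open scoped LinearAlgebra.Projectivization

namespace QuaternaryLCD

section Codes

variable {F : Type*} [Field F] {m n q : ℕ}

theorem hermInner_sum_smul {κ : Type*} (s : Finset κ) (f : κ → F) (v : κ → Fin n → F)
    (y : Fin n → F) :
    hermInner q (∑ i ∈ s, f i • v i) y = ∑ i ∈ s, f i * hermInner q (v i) y := by
  change (∑ i ∈ s, f i • v i) ⬝ᵥ (fun j => y j ^ q) = ∑ i ∈ s, f i * (v i ⬝ᵥ fun j => y j ^ q)
  simp only [sum_dotProduct, smul_dotProduct, smul_eq_mul]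

theorem hermInner_append (x y : Fin n → F) (x' y' : Fin m → F) :
    hermInner q (Fin.append x x') (Fin.append y y') = hermInner q x y + hermInner q x' y' := by
  simp only [hermInner, Fin.sum_univ_add, Fin.append_left, Fin.append_right]

theorem hammingNorm_append [DecidableEq F] (x : Fin n → F) (y : Fin m → F) :
    hammingNorm (Fin.append x y) = hammingNorm x + hammingNorm y := by
  simp only [hammingNorm, card_filter, Fin.sum_univ_add, Fin.append_left, Fin.append_right]

/-- A family of vectors is Hermitian orthonormal if its Gram matrix is the identity. -/
def HermOrthonormal {κ : Type*} [DecidableEq κ] (q : ℕ) (g : κ → Fin n → F) : Prop :=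
  ∀ i j, hermInner q (g i) (g j) = if i = j then 1 else 0

namespace HermOrthonormal

variable {κ : Type*} [DecidableEq κ] {g : κ → Fin n → F}

theorem hermInner_sum_smul_of_mem (hg : HermOrthonormal q g) {s : Finset κ} (f : κ → F) {j : κ}
    (hj : j ∈ s) : hermInner q (∑ i ∈ s, f i • g i) (g j) = f j := by
  simp only [hermInner_sum_smul, hg _ j, mul_ite, mul_one, mul_zero, sum_ite_eq', hj, if_true]

theorem linearIndependent (hg : HermOrthonormal q g) : LinearIndependent F g := by
  refine linearIndependent_iff'.mpr fun s f hf j hj => ?_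
  rw [← hg.hermInner_sum_smul_of_mem f hj, hf]
  exact zero_dotProduct _

theorem isHermitianLCD_span (hg : HermOrthonormal q g) :
    IsHermitianLCD q (Submodule.span F (Set.range g)) := by
  refine (Submodule.eq_bot_iff _).mpr fun x ⟨hx, hx'⟩ => ?_
  obtain ⟨f, rfl⟩ := Finsupp.mem_span_range_iff_exists_finsupp.mp hx
  refine sum_eq_zero fun j hj => ?_
  have hfj : f j = 0 := by
    rw [← hg.hermInner_sum_smul_of_mem f hj]
    exact hx' _ (Submodule.subset_span ⟨j, rfl⟩)
  simp only [hfj, zero_smul]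

end HermOrthonormal

variable {C : Submodule F (Fin n → F)}

theorem IsCode.range [DecidableEq F] {N k d w : ℕ} (hC : IsCode n k d C)
    (T : C →ₗ[F] Fin N → F)
    (hT : ∀ x, x ≠ 0 → hammingNorm (T x) = hammingNorm (x : Fin n → F) + w) :
    IsCode N k (d + w) (LinearMap.range T) := by
  obtain ⟨hdim, ⟨x, hxC, hx, rfl⟩, hmin⟩ := hC
  have hT₀ : ∀ y, y ≠ 0 → T y ≠ 0 := fun y hy => by
    rw [← hammingNorm_pos_iff, hT y hy]
    exact Nat.add_pos_left (hammingNorm_pos_iff.mpr fun h => hy (Subtype.ext h)) w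
  refine ⟨?_, ⟨T ⟨x, hxC⟩, ⟨_, rfl⟩, hT₀ _ ?_, hT _ ?_⟩, ?_⟩
  · have hinj : Function.Injective T :=
      (injective_iff_map_eq_zero T).mpr fun y => not_imp_not.mp (hT₀ y)
    rw [LinearMap.finrank_range_of_inj hinj, hdim]
  · exact fun h => hx (congrArg Subtype.val h)
  · exact fun h => hx (congrArg Subtype.val h)
  · rintro _ ⟨_, ⟨y, rfl⟩, hy, rfl⟩
    have hy₀ : y ≠ 0 := fun h => hy (by rw [h, map_zero])
    rw [hT y hy₀]
    exact Nat.add_le_add_right (hmin ⟨y, y.2, fun h => hy₀ (Subtype.ext h), rfl⟩) w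

theorem IsHermitianLCD.range {N : ℕ} (hC : IsHermitianLCD q C) (T : C →ₗ[F] Fin N → F)
    (hT : ∀ x y, hermInner q (T x) (T y) = hermInner q (x : Fin n → F) y) :
    IsHermitianLCD q (LinearMap.range T) := by
  refine (Submodule.eq_bot_iff _).mpr ?_
  rintro _ ⟨⟨x, rfl⟩, hx⟩
  have hxC : (x : Fin n → F) ∈ C ⊓ hermDual q C :=
    ⟨x.2, fun y hy => by rw [← hT x ⟨y, hy⟩]; exact hx _ ⟨_, rfl⟩⟩
  rw [hC, Submodule.mem_bot, ZeroMemClass.coe_eq_zero] at hxC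
  rw [hxC, map_zero]

/-- The encoder `x ↦ (x, S x)` of the juxtaposition of the code `C` with the image of `S`. -/
def juxtapose (S : C →ₗ[F] Fin m → F) : C →ₗ[F] Fin (n + m) → F where
  toFun x := Fin.append x (S x)
  map_add' x y := by ext i; refine i.addCases ?_ ?_ <;> simp
  map_smul' a x := by ext i; refine i.addCases ?_ ?_ <;> simp

theorem IsCode.juxtapose [DecidableEq F] {k d w : ℕ} (hC : IsCode n k d C)
    {S : C →ₗ[F] Fin m → F} (hS : ∀ x, x ≠ 0 → hammingNorm (S x) = w) :
    IsCode (n + m) k (d + w) (LinearMap.range (juxtapose S)) :=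
  hC.range _ fun x hx => by rw [← hS x hx]; exact hammingNorm_append _ _

theorem IsHermitianLCD.juxtapose (hC : IsHermitianLCD q C) {S : C →ₗ[F] Fin m → F}
    (hS : ∀ x y, hermInner q (S x) (S y) = 0) :
    IsHermitianLCD q (LinearMap.range (juxtapose S)) :=
  hC.range _ fun x y => by
    rw [← add_zero (hermInner q (x : Fin n → F) y), ← hS x y]
    exact hermInner_append _ _ _ _

end Codes

section Simplex

variable {K V : Type*} [Field K] [AddCommGroup V] [Module K V]

theorem sum_eq_zero_add_card_units_nsmul_sum_rep {M : Type*} [AddCommMonoid M] [Fintype K]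
    [DecidableEq K] [Fintype V] [Fintype (ℙ K V)] (f : V → M)
    (hf : ∀ (a : Kˣ) (v : V), f (a • v) = f v) :
    ∑ v, f v = f 0 + Fintype.card Kˣ • ∑ p : ℙ K V, f p.rep := by
  classical
  let e := Projectivization.nonZeroEquivProjectivizationProdUnits K V
  have hrep (v : {v : V // v ≠ 0}) : f v = f (e v).1.rep := by
    obtain ⟨a, ha⟩ := Projectivization.exists_smul_eq_mk_rep K v.1 v.2
    rw [← hf a, ha]
    rfl
  calc ∑ v, f v = f 0 + ∑ v : {v : V // v ≠ 0}, f v := by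
        rw [← add_sum_erase _ f (mem_univ 0), sum_subtype _ (p := (· ≠ 0)) (by simp)]
    _ = f 0 + ∑ z : ℙ K V × Kˣ, f z.1.rep := by
        rw [← e.sum_comp, Fintype.sum_congr _ _ hrep]
    _ = f 0 + Fintype.card Kˣ • ∑ p : ℙ K V, f p.rep := by
        simp only [Fintype.sum_prod_type, sum_const, card_univ, smul_sum]

variable [Fintype K] [FiniteDimensional K V]

theorem card_dual_ne_zero [DecidableEq K] [Fintype V] {φ : Module.Dual K V} (hφ : φ ≠ 0) :
    #{v | φ v ≠ 0} = (Fintype.card K - 1) * Fintype.card K ^ (Module.finrank K V - 1) := by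
  have hker : #{v | φ v = 0} = Fintype.card K ^ (Module.finrank K V - 1) := by
    rw [← Module.Dual.finrank_ker_add_one_of_ne_zero hφ, Nat.add_sub_cancel,
      ← Nat.card_eq_fintype_card, ← Module.natCard_eq_pow_finrank, ← Fintype.card_subtype,
      ← Nat.card_eq_fintype_card]
    rfl
  have hsum := card_filter_add_card_filter_not (s := univ) fun v => φ v = 0
  rw [hker, card_univ, Module.card_eq_pow_finrank (K := K) (V := V),
    ← Module.Dual.finrank_ker_add_one_of_ne_zero hφ, Nat.add_sub_cancel, pow_succ'] at hsum
  rw [← Module.Dual.finrank_ker_add_one_of_ne_zero hφ, Nat.add_sub_cancel, Nat.sub_one_mul]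
  exact Nat.eq_sub_of_add_eq' hsum

theorem card_projectivization_dual_rep_ne_zero [DecidableEq K] [Fintype (ℙ K V)]
    {φ : Module.Dual K V} (hφ : φ ≠ 0) :
    #{p : ℙ K V | φ p.rep ≠ 0} = Fintype.card K ^ (Module.finrank K V - 1) := by
  have : Finite V := Module.finite_of_finite K
  have := Fintype.ofFinite V
  have hpoints := sum_eq_zero_add_card_units_nsmul_sum_rep (K := K)
    (fun v => if φ v ≠ 0 then 1 else 0) fun a v => by simp [Units.smul_def]
  rw [map_zero, if_neg (not_not.mpr rfl), zero_add, ← card_filter, ← card_filter,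
    card_dual_ne_zero hφ, Fintype.card_units] at hpoints
  exact (Nat.eq_of_mul_eq_mul_left (Nat.sub_pos_of_lt Fintype.one_lt_card) hpoints).symm

/-- In coordinates both linear forms are linear polynomials in `finrank K V` variables, so this is
an instance of the Chevalley–Warning vanishing. -/
theorem sum_dual_mul_pow_eq_zero [Fintype V] (φ ψ : Module.Dual K V) {r : ℕ}
    (hr : r + 1 < (Fintype.card K - 1) * Module.finrank K V) :
    ∑ v, φ v * ψ v ^ r = 0 := by
  let b := Module.finBasis K V
  let poly (χ : Module.Dual K V) : MvPolynomial (Fin (Module.finrank K V)) K :=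
    χ.toMvPolynomial b (Module.Basis.singleton Unit K) ()
  have heval (χ x) : MvPolynomial.eval x (poly χ) = χ (b.equivFun.symm x) :=
    (LinearMap.toMvPolynomial_eval_eq_apply b (Module.Basis.singleton Unit K) χ ()
      (Finsupp.equivFunOnFinite.symm x)).trans (Module.Basis.singleton_repr ..)
  have hdeg (χ) : (poly χ).totalDegree ≤ 1 := LinearMap.toMvPolynomial_totalDegree_le b _ χ ()
  rw [← b.equivFun.symm.toEquiv.sum_comp, ← MvPolynomial.sum_eval_eq_zero (poly φ * poly ψ ^ r)]
  · simp only [map_mul, map_pow, heval, LinearEquiv.coe_toEquiv]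
  · calc (poly φ * poly ψ ^ r).totalDegree
        ≤ (poly φ).totalDegree + r * (poly ψ).totalDegree :=
          (MvPolynomial.totalDegree_mul _ _).trans
            (Nat.add_le_add_left (MvPolynomial.totalDegree_pow _ _) _)
      _ ≤ 1 + r * 1 := Nat.add_le_add (hdeg φ) (Nat.mul_le_mul_left r (hdeg ψ))
      _ < _ := by rwa [mul_one, add_comm, Fintype.card_fin]

/-- The summand does not depend on the chosen representatives, as `a ^ (r + 1) = 1` for `a ≠ 0`. -/
theorem sum_projectivization_dual_mul_pow_eq_zero [Fintype (ℙ K V)] (φ ψ : Module.Dual K V)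
    {r : ℕ} (hr : r + 2 = Fintype.card K) (hV : 2 ≤ Module.finrank K V) :
    ∑ p : ℙ K V, φ p.rep * ψ p.rep ^ r = 0 := by
  classical
  have : Finite V := Module.finite_of_finite K
  have := Fintype.ofFinite V
  have hunit (a : Kˣ) : (a : K) ^ (r + 1) = 1 := by
    rw [show r + 1 = Fintype.card K - 1 by omega]
    exact FiniteField.pow_card_sub_one_eq_one _ a.ne_zero
  have hpoints := sum_eq_zero_add_card_units_nsmul_sum_rep (K := K)
    (fun v => φ v * ψ v ^ r) fun a v => by
      simp only [Units.smul_def, map_smul, smul_eq_mul]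
      linear_combination φ v * ψ v ^ r * hunit a
  have hcard : (Fintype.card Kˣ : K) = -1 := by
    rw [Fintype.card_units, Nat.cast_sub Fintype.card_pos, FiniteField.cast_card_eq_zero]
    simp
  rw [sum_dual_mul_pow_eq_zero φ ψ, map_zero, zero_mul, zero_add, nsmul_eq_mul, hcard,
    neg_one_mul, eq_comm, neg_eq_zero] at hpoints
  · exact hpoints
  · calc r + 1 < (r + 1) * 2 := by omega
      _ ≤ (Fintype.card K - 1) * Module.finrank K V := Nat.mul_le_mul (by omega) hV

variable (K V) in
/-- The encoder of the simplex code on the message space `V`: evaluation at one linear form out of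
each point of the dual projective space. -/
noncomputable def simplexEncoder : V →ₗ[K] ℙ K (Module.Dual K V) → K :=
  LinearMap.pi fun p => p.rep

theorem hammingNorm_simplexEncoder [DecidableEq K] [Fintype (ℙ K (Module.Dual K V))] {x : V}
    (hx : x ≠ 0) :
    hammingNorm (simplexEncoder K V x) = Fintype.card K ^ (Module.finrank K V - 1) := by
  have hev : Module.Dual.eval K V x ≠ 0 := (Module.eval_apply_eq_zero_iff K x).not.mpr hx
  rw [← Subspace.dual_finrank_eq]
  exact card_projectivization_dual_rep_ne_zero hev

theorem sum_simplexEncoder_mul_pow_eq_zero [Fintype (ℙ K (Module.Dual K V))] (x y : V) {r : ℕ}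
    (hr : r + 2 = Fintype.card K) (hV : 2 ≤ Module.finrank K V) :
    ∑ p, simplexEncoder K V x p * simplexEncoder K V y p ^ r = 0 :=
  sum_projectivization_dual_mul_pow_eq_zero (Module.Dual.eval K V x) (Module.Dual.eval K V y) hr
    (by rwa [Subspace.dual_finrank_eq])

theorem exists_simplexCode [DecidableEq K] {r : ℕ} (hr : r + 2 = Fintype.card K)
    (hV : 2 ≤ Module.finrank K V) :
    ∃ S : V →ₗ[K] Fin ((Fintype.card K ^ Module.finrank K V - 1) / (Fintype.card K - 1)) → K,
      (∀ x, x ≠ 0 → hammingNorm (S x) = Fintype.card K ^ (Module.finrank K V - 1)) ∧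
      ∀ x y, hermInner r (S x) (S y) = 0 := by
  have : Finite (Module.Dual K V) := Module.finite_of_finite K
  have := Fintype.ofFinite (ℙ K (Module.Dual K V))
  have hcard : Fintype.card (ℙ K (Module.Dual K V)) =
      (Fintype.card K ^ Module.finrank K V - 1) / (Fintype.card K - 1) := by
    rw [← Nat.card_eq_fintype_card, Projectivization.card'',
      Module.natCard_eq_pow_finrank (K := K), Subspace.dual_finrank_eq, Nat.card_eq_fintype_card]
  let e := (Fintype.equivFinOfCardEq hcard).symm
  refine ⟨LinearMap.funLeft K K e ∘ₗ simplexEncoder K V, fun x hx => ?_, fun x y => ?_⟩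
  · rw [← hammingNorm_simplexEncoder hx, hammingNorm, hammingNorm, card_filter, card_filter]
    exact e.sum_comp fun p => if simplexEncoder K V x p ≠ 0 then 1 else 0
  · rw [← sum_simplexEncoder_mul_pow_eq_zero x y hr hV]
    exact e.sum_comp fun p => simplexEncoder K V x p * simplexEncoder K V y p ^ r

end Simplex

theorem exists_isHermitianLCD_add_simplex {F : Type*} [Field F] [Fintype F] [DecidableEq F]
    (hF : Fintype.card F = 4) {n k d : ℕ} (hk : 2 ≤ k) {C : Submodule F (Fin n → F)}
    (hC : IsCode n k d C) (hL : IsHermitianLCD 2 C) (s : ℕ) :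
    ∃ C' : Submodule F (Fin (n + (4 ^ k - 1) / 3 * s) → F),
      IsCode (n + (4 ^ k - 1) / 3 * s) k (d + 4 ^ (k - 1) * s) C' ∧ IsHermitianLCD 2 C' := by
  induction s with
  | zero => exact ⟨C, hC, hL⟩
  | succ s ih =>
    obtain ⟨D, hD, hDL⟩ := ih
    have hsimplex := exists_simplexCode (K := F) (V := D) hF.symm (hk.trans_eq hD.1.symm)
    rw [hF, hD.1] at hsimplex
    obtain ⟨S, hweight, hself⟩ := hsimplex
    rw [mul_add_one, mul_add_one, ← add_assoc, ← add_assoc]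
    exact ⟨_, hD.juxtapose hweight, hDL.juxtapose hself⟩

section FieldOfFourElements

variable {F : Type*} [Field F] {ω : F}

/-- `ω` is a primitive element of the field of four elements, whose elements are then `0`, `1`, `ω`
and `ω + 1`. -/
structure IsGenerator (ω : F) : Prop where
  two_eq_zero : (2 : F) = 0
  mul_self : ω * ω = ω + 1
  cases : ∀ x : F, x = 0 ∨ x = 1 ∨ x = ω ∨ x = ω + 1

theorem exists_isGenerator [Fintype F] (hF : Fintype.card F = 4) : ∃ ω : F, IsGenerator ω := by
  classical
  have h2 : (2 : F) = 0 := by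
    have h4 : ((Fintype.card F : ℕ) : F) = 0 := FiniteField.cast_card_eq_zero F
    refine mul_self_eq_zero.mp ?_
    rw [← h4, hF]
    norm_num
  have hquad : ∀ x : F, x ≠ 0 → x ≠ 1 → x * x + x + 1 = 0 := fun x hx₀ hx₁ => by
    have hcube : x ^ 3 = 1 := by simpa only [hF] using FiniteField.pow_card_sub_one_eq_one x hx₀
    refine (mul_eq_zero.mp ?_).resolve_left (sub_ne_zero.mpr hx₁)
    linear_combination hcube
  obtain ⟨ω, -, hω⟩ := exists_mem_notMem_of_card_lt_card
    (show #({0, 1} : Finset F) < #univ from card_le_two.trans_lt (by rw [card_univ, hF]; norm_num))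
  rw [mem_insert, mem_singleton, not_or] at hω
  have hω₂ := hquad ω hω.1 hω.2
  refine ⟨ω, h2, by linear_combination hω₂ - (ω + 1) * h2, fun x => ?_⟩
  refine or_iff_not_imp_left.mpr fun hx₀ => or_iff_not_imp_left.mpr fun hx₁ => ?_
  rw [← sub_eq_zero, ← sub_eq_zero (b := ω + 1), ← mul_eq_zero]
  linear_combination hquad x hx₀ hx₁ + hω₂ - (x + ω * x + 1) * h2

theorem IsGenerator.ne_zero (hω : IsGenerator ω) : ω ≠ 0 := by
  rintro rfl
  simpa using hω.mul_self

theorem IsGenerator.add_one_ne_zero (hω : IsGenerator ω) : ω + 1 ≠ 0 := by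
  rw [← hω.mul_self]
  exact mul_ne_zero hω.ne_zero hω.ne_zero

/-- The field element `a + b ω` encoded by the pair of bits `(a, b)`. -/
def ofBits (ω : F) (c : Bool × Bool) : F :=
  (if c.1 then 1 else 0) + if c.2 then ω else 0

theorem ofBits_xor (hω : IsGenerator ω) (c e : Bool × Bool) :
    ofBits ω (c.1 ^^ e.1, c.2 ^^ e.2) = ofBits ω c + ofBits ω e := by
  have h2 := hω.two_eq_zero
  obtain ⟨_ | _, _ | _⟩ := c <;> obtain ⟨_ | _, _ | _⟩ := e <;> grind [ofBits]

theorem mul_ofBits (hω : IsGenerator ω) (c : Bool × Bool) :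
    ω * ofBits ω c = ofBits ω (c.2, c.1 ^^ c.2) := by
  have hω₂ := hω.mul_self
  have h2 := hω.two_eq_zero
  obtain ⟨_ | _, _ | _⟩ := c <;> grind [ofBits]

theorem ofBits_eq_zero_iff (hω : IsGenerator ω) (c : Bool × Bool) :
    ofBits ω c = 0 ↔ (c.1 || c.2) = false := by
  have h₀ := hω.ne_zero
  have h₁ := hω.add_one_ne_zero
  obtain ⟨_ | _, _ | _⟩ := c <;> grind [ofBits]

theorem ofBits_mul_ofBits_sq (hω : IsGenerator ω) (c e : Bool × Bool) :
    ofBits ω c * ofBits ω e ^ 2 =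
      ofBits ω ((c.1 && (e.1 ^^ e.2)) ^^ (c.2 && e.2), (c.1 && e.2) ^^ (c.2 && e.1)) := by
  have hω₂ := hω.mul_self
  have h2 := hω.two_eq_zero
  obtain ⟨_ | _, _ | _⟩ := c <;> obtain ⟨_ | _, _ | _⟩ := e <;> grind [ofBits]

end FieldOfFourElements

/-- A vector over the field of four elements, packed into two bit masks: its `i`-th entry is
`a + b ω`, where `a` and `b` are the `i`-th bits of `lo` and `hi`. -/
@[ext]
structure PackedVec where
  lo : ℕ
  hi : ℕ
deriving DecidableEq

namespace PackedVec

instance : Zero PackedVec := ⟨⟨0, 0⟩⟩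

instance : Add PackedVec := ⟨fun r t => ⟨r.lo ^^^ t.lo, r.hi ^^^ t.hi⟩⟩

/-- Multiplication by the generator `ω`. -/
def mulOmega (r : PackedVec) : PackedVec := ⟨r.hi, r.lo ^^^ r.hi⟩

/-- Multiplication by the scalar encoded by a pair of bits. -/
def smul : Bool × Bool → PackedVec → PackedVec
  | (false, false), _ => 0
  | (true, false), r => r
  | (false, true), r => r.mulOmega
  | (true, true), r => r.mulOmega.mulOmega

/-- The `i`-th entry, as a pair of bits. -/
def entry (r : PackedVec) (i : ℕ) : Bool × Bool := (r.lo.testBit i, r.hi.testBit i)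

/-- The bit mask of the positions with a nonzero entry. -/
def support (r : PackedVec) : ℕ := r.lo ||| r.hi

/-- The parity of the number of ones among the lowest `2 ^ j` bits of `y`. -/
def parity : ℕ → ℕ → Bool
  | 0, y => y.testBit 0
  | j + 1, y => parity j (y ^^^ (y >>> 2 ^ j))

/-- The Hermitian inner product of the first `n ≤ 2 ^ 5` entries. -/
def herm (n : ℕ) (r t : PackedVec) : Bool × Bool :=
  (parity 5 (((r.lo &&& (t.lo ^^^ t.hi)) ^^^ (r.hi &&& t.hi)) % 2 ^ n),
    parity 5 (((r.lo &&& t.hi) ^^^ (r.hi &&& t.lo)) % 2 ^ n))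

variable {F : Type*} [Field F] {ω : F} {n : ℕ}

/-- The vector of length `n` that is packed into `r`. -/
def unpack (ω : F) (n : ℕ) (r : PackedVec) : Fin n → F := fun i => ofBits ω (r.entry i)

theorem unpack_zero : unpack ω n 0 = 0 := by
  funext i
  change ofBits ω (Nat.testBit 0 i, Nat.testBit 0 i) = 0
  simp [ofBits]

theorem unpack_add (hω : IsGenerator ω) (r t : PackedVec) :
    unpack ω n (r + t) = unpack ω n r + unpack ω n t := by
  funext i
  rw [Pi.add_apply]
  simp only [unpack, ← ofBits_xor hω, entry]
  rw [← Nat.testBit_xor, ← Nat.testBit_xor]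
  rfl

theorem unpack_list_sum (hω : IsGenerator ω) (l : List PackedVec) :
    unpack ω n l.sum = (l.map (unpack ω n)).sum := by
  induction l with
  | nil => exact unpack_zero
  | cons r l ih => rw [List.sum_cons, unpack_add hω, ih, List.map_cons, List.sum_cons]

theorem unpack_mulOmega (hω : IsGenerator ω) (r : PackedVec) :
    unpack ω n r.mulOmega = ω • unpack ω n r := by
  funext i
  simp only [unpack, mulOmega, entry, Nat.testBit_xor, Pi.smul_apply, smul_eq_mul, mul_ofBits hω]

theorem unpack_smul (hω : IsGenerator ω) (c : Bool × Bool) (r : PackedVec) :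
    unpack ω n (smul c r) = ofBits ω c • unpack ω n r := by
  obtain ⟨_ | _, _ | _⟩ := c <;>
    simp [smul, ofBits, unpack_zero, unpack_mulOmega hω, smul_smul, hω.mul_self, add_comm]

theorem sum_ofBits_testBit (hω : IsGenerator ω) (j y z : ℕ) :
    ∑ i ∈ range (2 ^ j), ofBits ω (y.testBit i, z.testBit i) =
      ofBits ω (parity j y, parity j z) := by
  induction j generalizing y z with
  | zero => simp [parity]
  | succ j ih =>
    rw [parity, parity, ← ih, pow_succ, mul_two, sum_range_add, ← sum_add_distrib]
    refine sum_congr rfl fun i _ => ?_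
    rw [← ofBits_xor hω, Nat.testBit_xor, Nat.testBit_xor, Nat.testBit_shiftRight,
      Nat.testBit_shiftRight]

theorem hermInner_unpack (hω : IsGenerator ω) (hn : n ≤ 2 ^ 5) (r t : PackedVec) :
    hermInner 2 (unpack ω n r) (unpack ω n t) = ofBits ω (herm n r t) := by
  rw [herm, ← sum_ofBits_testBit hω, ← sum_subset (range_subset_range.mpr hn),
    ← Fin.sum_univ_eq_sum_range]
  · refine sum_congr rfl fun i _ => ?_
    simp only [unpack, entry, ofBits_mul_ofBits_sq hω, Nat.testBit_mod_two_pow, Nat.testBit_xor,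
      Nat.testBit_and, i.2, decide_true, Bool.true_and]
  · intro i _ hi
    rw [mem_range] at hi
    simp [Nat.testBit_mod_two_pow, hi, ofBits]

theorem hammingNorm_unpack [DecidableEq F] (hω : IsGenerator ω) (r : PackedVec) :
    hammingNorm (unpack ω n r) = #{i : Fin n | r.support.testBit i} := by
  simp only [hammingNorm, unpack, ne_eq, ofBits_eq_zero_iff hω, entry, support, Nat.testBit_or,
    Bool.not_eq_false]

end PackedVec

open PackedVec

/-- Whether the binary expansion of a number has at least `d` ones; each step clears the lowest one.
Here and in `translatesHaveWeight` the recursors are applied explicitly, because the kernel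
evaluates them much faster than compiled structural recursion. -/
def hasOnes (d : ℕ) : ℕ → Bool :=
  Nat.rec (fun _ => true) (fun _ f y => Nat.casesOn y false fun z => f ((z + 1) &&& z)) d

theorem le_card_testBit_of_hasOnes {n d y : ℕ} (hy : y < 2 ^ n) (h : hasOnes d y) :
    d ≤ #{i : Fin n | y.testBit i} := by
  induction d generalizing y with
  | zero => exact Nat.zero_le _
  | succ d ih =>
    obtain _ | y := y
    · exact absurd h Bool.false_ne_true
    have hlt : (y + 1) &&& y < y + 1 := Nat.lt_succ_of_le Nat.and_le_right
    refine (ih (hlt.trans hy) h).trans_lt (card_lt_card ?_)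
    obtain ⟨i, hi⟩ := Nat.exists_testBit_ne_of_ne hlt.ne
    rw [Nat.testBit_and] at hi
    have hi₁ : (y + 1).testBit i = true := by grind
    have hin : i < n := by
      by_contra! hni
      have := Nat.testBit_lt_two_pow (hy.trans_le (Nat.pow_le_pow_right two_pos hni))
      grind
    refine (ssubset_iff_of_subset (monotone_filter_right _ fun i _ hi => ?_)).mpr ⟨⟨i, hin⟩, ?_⟩
    · rw [Nat.testBit_and, Bool.and_eq_true] at hi
      exact hi.1
    · simpa [hi₁] using hi

section InformationSets

/-- The combination of the words of `L` whose coefficients are the entries of `x` at the positions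
that `L` pairs with them. If `L` is an information set of a code together with the corresponding
rows of the systematic generator matrix, this recovers a code word `x` from its entries there. -/
def recover {n : ℕ} (L : List (Fin n × PackedVec)) (x : PackedVec) : PackedVec :=
  (L.map fun p => smul (x.entry p.1) p.2).sum

/-- Whether all sums of `r` and a combination of at most `w` words of `L` have weight at least
`d`. -/
def translatesHaveWeight {ι : Type*} (n d : ℕ) (L : List (ι × PackedVec)) :
    ℕ → PackedVec → Bool :=
  List.rec (fun _ r => hasOnes d (r.support % 2 ^ n))
    (fun p _ f w r => Nat.casesOn w (hasOnes d (r.support % 2 ^ n)) fun w =>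
      f (w + 1) r && (f w (r + p.2) && (f w (r + p.2.mulOmega) &&
        f w (r + p.2.mulOmega.mulOmega)))) L

/-- Whether all nontrivial combinations of at most `w` words of `L` have weight at least `d`. Up to
scaling, the first nonzero coefficient is `1`. -/
def combosHaveWeight {ι : Type*} (n d : ℕ) : List (ι × PackedVec) → ℕ → Bool
  | [], _ => true
  | _ :: _, 0 => true
  | (_, t) :: L, w + 1 => combosHaveWeight n d L (w + 1) && translatesHaveWeight n d L w t

variable {F : Type*} [Field F] {ω : F} {n d : ℕ}

/-- The linear map over the field of four elements that `recover` computes on packed vectors. -/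
def combine (ω : F) (L : List (Fin n × PackedVec)) : (Fin n → F) →ₗ[F] Fin n → F :=
  (L.map fun p => (LinearMap.proj p.1 : (Fin n → F) →ₗ[F] F).smulRight (unpack ω n p.2)).sum

theorem combine_nil (x : Fin n → F) : combine ω [] x = 0 := rfl

theorem combine_cons (p : Fin n × PackedVec) (L : List (Fin n × PackedVec)) (x : Fin n → F) :
    combine ω (p :: L) x = x p.1 • unpack ω n p.2 + combine ω L x := by
  simp only [combine, List.map_cons, List.sum_cons, LinearMap.add_apply,
    LinearMap.smulRight_apply, LinearMap.proj_apply]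

theorem unpack_recover (hω : IsGenerator ω) (L : List (Fin n × PackedVec)) (x : PackedVec) :
    unpack ω n (recover L x) = combine ω L (unpack ω n x) := by
  induction L with
  | nil => exact unpack_zero
  | cons p L ih =>
    rw [combine_cons, ← ih]
    simp only [recover, List.map_cons, List.sum_cons, unpack_add hω, unpack_smul hω]
    rfl

variable [DecidableEq F]

/-- The weight of `x` on the positions listed in `L`. -/
def weightOn (L : List (Fin n × PackedVec)) (x : Fin n → F) : ℕ :=
  L.countP fun p => x p.1 ≠ 0

theorem weightOn_cons_of_eq_zero {p : Fin n × PackedVec} {x : Fin n → F} (h : x p.1 = 0)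
    (L : List (Fin n × PackedVec)) : weightOn (p :: L) x = weightOn L x :=
  List.countP_cons_of_neg (by simpa using h)

theorem weightOn_cons_of_ne_zero {p : Fin n × PackedVec} {x : Fin n → F} (h : x p.1 ≠ 0)
    (L : List (Fin n × PackedVec)) : weightOn (p :: L) x = weightOn L x + 1 :=
  List.countP_cons_of_pos (by simpa using h)

theorem weightOn_smul (L : List (Fin n × PackedVec)) {a : F} (ha : a ≠ 0) (x : Fin n → F) :
    weightOn L (a • x) = weightOn L x := by
  simp only [weightOn, Pi.smul_apply, smul_eq_mul, ne_eq, mul_eq_zero, ha, false_or]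

theorem combine_eq_zero_of_weightOn_eq_zero (L : List (Fin n × PackedVec)) {x : Fin n → F}
    (h : weightOn L x = 0) : combine ω L x = 0 := by
  induction L with
  | nil => exact combine_nil x
  | cons p L ih =>
    by_cases hp : x p.1 = 0
    · rw [combine_cons, hp, zero_smul, zero_add, ih (weightOn_cons_of_eq_zero hp L ▸ h)]
    · exact absurd ((weightOn_cons_of_ne_zero hp L).symm.trans h) (Nat.succ_ne_zero _)

theorem le_hammingNorm_unpack (hω : IsGenerator ω) {r : PackedVec}
    (h : hasOnes d (r.support % 2 ^ n)) : d ≤ hammingNorm (unpack ω n r) := by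
  rw [hammingNorm_unpack hω]
  simpa only [Nat.testBit_mod_two_pow, Fin.is_lt, decide_true, Bool.true_and] using
    le_card_testBit_of_hasOnes (Nat.mod_lt r.support (Nat.two_pow_pos n)) h

theorem le_hammingNorm_unpack_add_combine (hω : IsGenerator ω) {L : List (Fin n × PackedVec)}
    {w : ℕ} {r : PackedVec} (h : translatesHaveWeight n d L w r) {x : Fin n → F}
    (hx : weightOn L x ≤ w) : d ≤ hammingNorm (unpack ω n r + combine ω L x) := by
  induction L generalizing w r with
  | nil =>
    rw [combine_nil, add_zero]
    exact le_hammingNorm_unpack hω h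
  | cons p L ih =>
    obtain _ | w := w
    · rw [combine_eq_zero_of_weightOn_eq_zero _ (Nat.le_zero.mp hx), add_zero]
      exact le_hammingNorm_unpack hω h
    simp only [translatesHaveWeight, Bool.and_eq_true] at h ih
    obtain ⟨h₀, h₁, h₂, h₃⟩ := h
    rw [combine_cons, ← add_assoc]
    by_cases hp : x p.1 = 0
    · rw [hp, zero_smul, add_zero]
      exact ih h₀ (weightOn_cons_of_eq_zero hp L ▸ hx)
    · have hx' : weightOn L x ≤ w := by
        rwa [weightOn_cons_of_ne_zero hp, Nat.add_le_add_iff_right] at hx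
      obtain hp₁ | hp₂ | hp₃ := (hω.cases (x p.1)).resolve_left hp
      · rw [hp₁, one_smul, ← unpack_add hω]
        exact ih h₁ hx'
      · rw [hp₂, ← unpack_mulOmega hω, ← unpack_add hω]
        exact ih h₂ hx'
      · rw [hp₃, ← hω.mul_self, mul_smul, ← unpack_mulOmega hω, ← unpack_mulOmega hω,
          ← unpack_add hω]
        exact ih h₃ hx'

theorem le_hammingNorm_combine (hω : IsGenerator ω) {L : List (Fin n × PackedVec)} {w : ℕ}
    (h : combosHaveWeight n d L w) {x : Fin n → F} (hx : weightOn L x ≤ w)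
    (hx₀ : weightOn L x ≠ 0) : d ≤ hammingNorm (combine ω L x) := by
  induction L generalizing w with
  | nil => exact absurd rfl hx₀
  | cons p L ih =>
    obtain _ | w := w
    · exact absurd (Nat.le_zero.mp hx) hx₀
    rw [combosHaveWeight, Bool.and_eq_true] at h
    rw [combine_cons]
    by_cases hp : x p.1 = 0
    · rw [weightOn_cons_of_eq_zero hp] at hx hx₀
      rw [hp, zero_smul, zero_add]
      exact ih h.1 hx hx₀
    · rw [weightOn_cons_of_ne_zero hp] at hx
      have hscale : x p.1 • unpack ω n p.2 + combine ω L x =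
          x p.1 • (unpack ω n p.2 + combine ω L ((x p.1)⁻¹ • x)) := by
        rw [smul_add, ← map_smul, smul_inv_smul₀ hp]
      rw [hscale, hammingNorm_smul fun _ => IsSMulRegular.of_ne_zero hp]
      refine le_hammingNorm_unpack_add_combine hω h.2 ?_
      rw [weightOn_smul L (inv_ne_zero hp)]
      exact Nat.le_of_succ_le_succ hx

end InformationSets

theorem countP_le_mul_card_filter {α : Type*} [DecidableEq α] [Fintype α] {l : List α} {m : ℕ}
    (hl : ∀ a, l.count a ≤ m) (p : α → Prop) [DecidablePred p] :
    l.countP p ≤ m * #{a | p a} := by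
  calc l.countP p
    _ = ∑ a with p a, ((l : Multiset α).filter p).count a := by
        rw [Multiset.sum_count_eq_card fun a ha => by simpa using Multiset.of_mem_filter ha]
        simp [List.countP_eq_length_filter]
    _ ≤ ∑ a with p a, m := sum_le_sum fun a _ =>
        (Multiset.count_le_of_le a (Multiset.filter_le _ _)).trans (Multiset.coe_count a l ▸ hl a)
    _ = m * #{a | p a} := by rw [sum_const, smul_eq_mul, mul_comm]

/-- Data certifying a Hermitian LCD `[n, k, d]` code: a Hermitian orthonormal basis, a code word of
weight `d`, and information sets, each with the rows of the systematic generator matrix. No position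
lies in more than `multiplicity` of the information sets, so that a word of weight less than `d`
has weight at most `bound` on one of them; combinations of at most `bound` rows are enumerated. -/
structure Certificate (n k d : ℕ) where
  basis : Fin k → PackedVec
  informationSets : List (List (Fin n × PackedVec))
  multiplicity : ℕ
  bound : ℕ
  minWord : PackedVec
  length_le : n ≤ 2 ^ 5 := by decide
  d_pos : 0 < d := by decide
  herm_basis : ∀ i j, herm n (basis i) (basis j) = (decide (i = j), false) := by decide +kernel
  recover_basis : ∀ L ∈ informationSets, ∀ i, recover L (basis i) = basis i := by decide +kernel
  count_le : ∀ i, (informationSets.flatten.map Prod.fst).count i ≤ multiplicity := by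
    decide +kernel
  lt_length_mul : multiplicity * (d - 1) < informationSets.length * (bound + 1) := by
    decide +kernel
  combosHaveWeight : ∀ L ∈ informationSets, combosHaveWeight n d L bound := by decide +kernel
  sum_minWord : (List.ofFn fun i => smul (herm n minWord (basis i)) (basis i)).sum = minWord := by
    decide +kernel
  card_minWord : #{i : Fin n | minWord.support.testBit i} = d := by decide +kernel

namespace Certificate

variable {F : Type*} [Field F] {ω : F} {n k d : ℕ} (c : Certificate n k d)

/-- The code spanned by the basis. -/
def code (ω : F) : Submodule F (Fin n → F) :=
  Submodule.span F (Set.range fun i => unpack ω n (c.basis i))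

theorem hermOrthonormal_basis (hω : IsGenerator ω) :
    HermOrthonormal 2 fun i => unpack ω n (c.basis i) := fun i j => by
  simp [hermInner_unpack hω c.length_le, c.herm_basis, ofBits]

theorem unpack_minWord_mem_code (hω : IsGenerator ω) : unpack ω n c.minWord ∈ c.code ω := by
  rw [← c.sum_minWord, unpack_list_sum hω]
  refine list_sum_mem fun v hv => ?_
  simp only [List.mem_map, List.mem_ofFn, exists_exists_eq_and, unpack_smul hω] at hv
  obtain ⟨i, rfl⟩ := hv
  exact Submodule.smul_mem _ _ (Submodule.subset_span ⟨i, rfl⟩)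

theorem combine_eq_self (hω : IsGenerator ω) {L : List (Fin n × PackedVec)}
    (hL : L ∈ c.informationSets) {x : Fin n → F} (hx : x ∈ c.code ω) : combine ω L x = x := by
  refine LinearMap.eqOn_span (f := combine ω L) (g := LinearMap.id) ?_ hx
  rintro _ ⟨i, rfl⟩
  rw [← unpack_recover hω, c.recover_basis L hL, LinearMap.id_apply]

variable [DecidableEq F]

theorem hammingNorm_minWord (hω : IsGenerator ω) : hammingNorm (unpack ω n c.minWord) = d := by
  rw [hammingNorm_unpack hω, c.card_minWord]

theorem sum_weightOn_le (x : Fin n → F) :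
    (c.informationSets.map fun L => weightOn L x).sum ≤ c.multiplicity * hammingNorm x := by
  have h := countP_le_mul_card_filter c.count_le fun i => x i ≠ 0
  rwa [List.countP_map, List.countP_flatten] at h

theorem exists_weightOn_le {x : Fin n → F} (hx : hammingNorm x < d) :
    ∃ L ∈ c.informationSets, weightOn L x ≤ c.bound := by
  by_contra! hbound
  refine absurd c.lt_length_mul (not_lt.mpr ?_)
  calc c.informationSets.length * (c.bound + 1)
    _ ≤ (c.informationSets.map fun L => weightOn L x).sum := by
        simpa using List.card_nsmul_le_sum (c.informationSets.map fun L => weightOn L x) _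
          (List.forall_mem_map.mpr hbound)
    _ ≤ c.multiplicity * hammingNorm x := c.sum_weightOn_le x
    _ ≤ c.multiplicity * (d - 1) := Nat.mul_le_mul_left _ (Nat.le_sub_one_of_lt hx)

theorem le_hammingNorm (hω : IsGenerator ω) {x : Fin n → F} (hx : x ∈ c.code ω) (hx₀ : x ≠ 0) :
    d ≤ hammingNorm x := by
  by_contra! hlt
  obtain ⟨L, hL, hLx⟩ := c.exists_weightOn_le hlt
  have hself := c.combine_eq_self hω hL hx
  have hLx₀ : weightOn L x ≠ 0 := fun h =>
    hx₀ (hself.symm.trans (combine_eq_zero_of_weightOn_eq_zero L h))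
  have hle := le_hammingNorm_combine hω (c.combosHaveWeight L hL) hLx hLx₀
  rw [hself] at hle
  exact hlt.not_ge hle

theorem hasMinWeight_code (hω : IsGenerator ω) : HasMinWeight (c.code ω) d := by
  refine ⟨⟨_, c.unpack_minWord_mem_code hω, ?_, c.hammingNorm_minWord hω⟩, ?_⟩
  · rw [← hammingNorm_pos_iff, c.hammingNorm_minWord hω]
    exact c.d_pos
  · rintro _ ⟨x, hx, hx₀, rfl⟩
    exact c.le_hammingNorm hω hx hx₀

theorem exists_isHermitianLCD (c : Certificate n k d) (hω : IsGenerator ω) :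
    ∃ C : Submodule F (Fin n → F), IsCode n k d C ∧ IsHermitianLCD 2 C := by
  have hbasis := c.hermOrthonormal_basis hω
  refine ⟨c.code ω, ⟨?_, c.hasMinWeight_code hω⟩, hbasis.isHermitianLCD_span⟩
  rw [code, finrank_span_eq_card hbasis.linearIndependent, Fintype.card_fin]

end Certificate

def certificate_21_8_9 : Certificate 21 8 9 where
  basis := ![
    ⟨0x185404, 0xbd700⟩, ⟨0x1ea805, 0x1e3704⟩, ⟨0x16de06, 0x1ef604⟩, ⟨0x77111, 0x15f203⟩,
    ⟨0x312f, 0x58811⟩, ⟨0x3c11a, 0xb9c38⟩, ⟨0x5b35f, 0x8ffb7⟩, ⟨0xffcec, 0x55aa6⟩]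
  informationSets := [
    List.zip [
      0, 1, 2, 3, 4, 5, 6, 7] [
      ⟨0xd2b01, 0x66300⟩, ⟨0x55d02, 0x6a200⟩, ⟨0x185404, 0xbd700⟩, ⟨0x34a08, 0x1e9800⟩,
      ⟨0xa9b10, 0x1b2600⟩, ⟨0xe1c20, 0xaf300⟩, ⟨0xc740, 0x158e00⟩, ⟨0x1bfb80, 0x64400⟩],
    List.zip [
      13, 14, 15, 16, 17, 18, 19, 20] [
      ⟨0x38c2, 0xd0b⟩, ⟨0x5ae7, 0x9a⟩, ⟨0x9c17, 0x16b5⟩, ⟨0x11107, 0x4b2⟩, ⟨0x20ff5, 0x1751⟩,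
      ⟨0x401e7, 0x1bea⟩, ⟨0x80209, 0x1c4e⟩, ⟨0x101568, 0x85d⟩]]
  multiplicity := 1
  bound := 4
  minWord := ⟨0xb4122, 0xc5100⟩

def certificate_21_10_8 : Certificate 21 10 8 where
  basis := ![
    ⟨0x187802, 0x1c0400⟩, ⟨0x60c03, 0x149802⟩, ⟨0x1e8407, 0x115801⟩, ⟨0xa800e, 0x1ce800⟩,
    ⟨0xb816, 0x159807⟩, ⟨0x18a42a, 0x1cb811⟩, ⟨0x134ea, 0x29025⟩, ⟨0x1108bb, 0x1a60c7⟩,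
    ⟨0x633fa, 0x19786f⟩, ⟨0x10f6ef, 0x1f8304⟩]
  informationSets := [
    List.zip [
      0, 1, 2, 3, 4, 5, 6, 7, 8, 9] [
      ⟨0x27001, 0xce000⟩, ⟨0x187802, 0x1c0400⟩, ⟨0x86c04, 0xf2c00⟩, ⟨0x1a9408, 0xfc000⟩,
      ⟨0xf6410, 0xb1c00⟩, ⟨0x1db420, 0x59400⟩, ⟨0x18840, 0x1e5400⟩, ⟨0x19bc80, 0x1b6400⟩,
      ⟨0x95900, 0xd9c00⟩, ⟨0xcaa00, 0x139c00⟩],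
    List.zip [
      11, 12, 13, 14, 15, 16, 17, 18, 19, 20] [
      ⟨0xda7, 0x3a7⟩, ⟨0x163d, 0x703⟩, ⟨0x21cb, 0x1ee⟩, ⟨0x43fc, 0x17c⟩, ⟨0x86d2, 0x7d6⟩,
      ⟨0x10498, 0x17f⟩, ⟨0x200dc, 0x751⟩, ⟨0x40492, 0x388⟩, ⟨0x80460, 0x1b⟩, ⟨0x10034c, 0x510⟩]]
  multiplicity := 1
  bound := 3
  minWord := ⟨0x27001, 0xce000⟩

def certificate_21_11_7 : Certificate 21 11 7 where
  basis := ![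
    ⟨0x11b801, 0x168000⟩, ⟨0x1b5803, 0x35000⟩, ⟨0xab005, 0x1ff802⟩, ⟨0x12900c, 0x1d5807⟩,
    ⟨0x191025, 0x12f802⟩, ⟨0x12c044, 0x13c000⟩, ⟨0xe6818, 0x19e841⟩, ⟨0x3014a, 0x11f078⟩,
    ⟨0x6a181, 0x95115⟩, ⟨0x16b57a, 0x1c29b9⟩, ⟨0x12fa70, 0x1ffdff⟩]
  informationSets := [
    List.zip [
      0, 1, 2, 3, 4, 5, 6, 7, 8, 9, 10] [
      ⟨0x11b801, 0x168000⟩, ⟨0xae002, 0x15d000⟩, ⟨0xed804, 0x164800⟩, ⟨0x95008, 0xb8800⟩,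
      ⟨0x143010, 0xcc800⟩, ⟨0x13a020, 0xd0000⟩, ⟨0x1c1840, 0x58800⟩, ⟨0x1f4880, 0xbe000⟩,
      ⟨0x136100, 0x173000⟩, ⟨0xd3200, 0x97000⟩, ⟨0x1dfc00, 0x24000⟩],
    List.zip [
      10, 11, 12, 13, 14, 15, 16, 17, 18, 19, 20] [
      ⟨0x795, 0x264⟩, ⟨0x965, 0x15c⟩, ⟨0x13a3, 0x164⟩, ⟨0x219c, 0x3d3⟩, ⟨0x415d, 0xc3⟩,
      ⟨0x81fb, 0xcd⟩, ⟨0x101af, 0x285⟩, ⟨0x2039e, 0x2a2⟩, ⟨0x4038e, 0x235⟩, ⟨0x8003b, 0x2d4⟩,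
      ⟨0x100012, 0x347⟩],
    List.zip [
      0, 1, 2, 3, 4, 5, 6, 7, 8, 9, 20] [
      ⟨0xe0401, 0xb7c00⟩, ⟨0x8a002, 0xa6c00⟩, ⟨0xc9804, 0x9f400⟩, ⟨0x95008, 0xb8800⟩,
      ⟨0x9cc10, 0xe8800⟩, ⟨0xe5c20, 0xf4000⟩, ⟨0x1e440, 0x7c800⟩, ⟨0x2b480, 0x9a000⟩,
      ⟨0xcdd00, 0xacc00⟩, ⟨0xd3200, 0x97000⟩, ⟨0x1dfc00, 0x24000⟩]]
  multiplicity := 2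
  bound := 4
  minWord := ⟨0xd3200, 0x97000⟩

def certificate_22_8_10 : Certificate 22 8 10 where
  basis := ![
    ⟨0x5be02, 0x267100⟩, ⟨0x290903, 0x38a302⟩, ⟨0x134205, 0xf0802⟩, ⟨0x111509, 0x42506⟩,
    ⟨0x29321c, 0x30a707⟩, ⟨0x13d224, 0x47d19⟩, ⟨0x2feb4e, 0x30211e⟩, ⟨0x2b45fb, 0x3cd369⟩]
  informationSets := [
    List.zip [
      0, 1, 2, 3, 4, 5, 6, 7] [
      ⟨0xac601, 0x3d1d00⟩, ⟨0x5be02, 0x267100⟩, ⟨0x3ff504, 0x11da00⟩, ⟨0x2c7808, 0x34d800⟩,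
      ⟨0x300910, 0x2f9e00⟩, ⟨0xa7c20, 0x254b00⟩, ⟨0x153540, 0x398500⟩, ⟨0x320e80, 0xccb00⟩],
    List.zip [
      14, 15, 16, 17, 18, 19, 20, 21] [
      ⟨0x7f6d, 0x2f87⟩, ⟨0x9259, 0x539⟩, ⟨0x137b3, 0x34ab⟩, ⟨0x2059e, 0x224b⟩, ⟨0x434c1, 0x198c⟩,
      ⟨0x83f1a, 0x3b1f⟩, ⟨0x103b36, 0x3ce0⟩, ⟨0x203805, 0x3b69⟩]]
  multiplicity := 1
  bound := 4
  minWord := ⟨0x2c7808, 0x34d800⟩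

def certificate_23_18_4 : Certificate 23 18 4 where
  basis := ![
    ⟨0x80001, 0x3c0000⟩, ⟨0x380005, 0x380000⟩, ⟨0x40007, 0x400005⟩, ⟨0x5c0015, 0x1c0000⟩,
    ⟨0x34001d, 0x680000⟩, ⟨0x40039, 0x14000b⟩, ⟨0x30004b, 0x80039⟩, ⟨0x8014f, 0x2c0004⟩,
    ⟨0x1c6, 0x24016e⟩, ⟨0x180832, 0x4400a2⟩, ⟨0xa87, 0x740892⟩, ⟨0x2010d8, 0x5c001c⟩,
    ⟨0x701e7b, 0x500b06⟩, ⟨0x308c54, 0x541f1e⟩, ⟨0x40ad81, 0x38821b⟩, ⟨0x69a10f, 0x3022ca⟩,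
    ⟨0x8e6c8, 0x5a3c16⟩, ⟨0x225b0b, 0x661bcd⟩]
  informationSets := [
    List.zip [
      0, 1, 2, 3, 4, 5, 6, 7, 8, 9, 10, 11, 12, 13, 14, 15, 16, 17] [
      ⟨0x80001, 0x3c0000⟩, ⟨0x40002, 0x780000⟩, ⟨0x300004, 0x40000⟩, ⟨0x680008, 0x740000⟩,
      ⟨0x640010, 0x240000⟩, ⟨0x300020, 0x2c0000⟩, ⟨0x140040, 0x4c0000⟩, ⟨0x640080, 0x480000⟩,
      ⟨0x4c0100, 0x600000⟩, ⟨0x600200, 0x380000⟩, ⟨0x340400, 0x140000⟩, ⟨0x540800, 0x780000⟩,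
      ⟨0x81000, 0x600000⟩, ⟨0x142000, 0x640000⟩, ⟨0x684000, 0x780000⟩, ⟨0x688000, 0x500000⟩,
      ⟨0x590000, 0x6c0000⟩, ⟨0x360000, 0x600000⟩]]
  multiplicity := 1
  bound := 3
  minWord := ⟨0x300004, 0x40000⟩

def certificate_24_16_6 : Certificate 24 16 6 where
  basis := ![
    ⟨0x225, 0xe8⟩, ⟨0x30c, 0x2cd⟩, ⟨0x10b3, 0xc0⟩, ⟨0x16c7, 0x1df⟩, ⟨0x81a6, 0x1604⟩,
    ⟨0x37cb, 0x961f⟩, ⟨0x2bf5, 0x92f3⟩, ⟨0x219a5, 0x8992⟩, ⟨0x2f812, 0x21958⟩, ⟨0x64700, 0x810f⟩,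
    ⟨0x1f576, 0x453a0⟩, ⟨0xe282d, 0x538c8⟩, ⟨0x19b0db, 0x59472⟩, ⟨0x59e0ed, 0x1f3691⟩,
    ⟨0x2c7fdb, 0x46c27c⟩, ⟨0xac7217, 0x4ca22⟩]
  informationSets := [
    List.zip [
      8, 9, 10, 11, 12, 13, 14, 15, 16, 17, 18, 19, 20, 21, 22, 23] [
      ⟨0x1c1, 0xe8⟩, ⟨0x225, 0xe8⟩, ⟨0x4b9, 0xde⟩, ⟨0x8ea, 0x95⟩, ⟨0x10b3, 0xc0⟩, ⟨0x20e6, 0x7c⟩,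
      ⟨0x4029, 0x14⟩, ⟨0x8091, 0x35⟩, ⟨0x100a2, 0xe8⟩, ⟨0x20075, 0xdd⟩, ⟨0x400dc, 0x95⟩,
      ⟨0x800dc, 0xfc⟩, ⟨0x100037, 0x5c⟩, ⟨0x2000b6, 0x14⟩, ⟨0x400070, 0x27⟩, ⟨0x800031, 0x7d⟩],
    List.zip [
      0, 1, 2, 3, 4, 5, 6, 7, 16, 17, 18, 19, 20, 21, 22, 23] [
      ⟨0xbd01, 0xb400⟩, ⟨0xae02, 0x8500⟩, ⟨0xad04, 0xd000⟩, ⟨0xa708, 0x4600⟩, ⟨0x7a10, 0xe00⟩,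
      ⟨0x8420, 0xfb00⟩, ⟨0xfc40, 0xee00⟩, ⟨0xd680, 0xc500⟩, ⟨0x16a00, 0x2400⟩, ⟨0x21500, 0x9f00⟩,
      ⟨0x4f500, 0xa000⟩, ⟨0x81200, 0x2500⟩, ⟨0x103600, 0xee00⟩, ⟨0x20f500, 0x6c00⟩,
      ⟨0x401800, 0x3b00⟩, ⟨0x807a00, 0xcd00⟩],
    List.zip [
      0, 1, 2, 3, 4, 5, 6, 7, 8, 9, 10, 11, 12, 13, 14, 15] [
      ⟨0xfe0001, 0xbd0000⟩, ⟨0x310002, 0x3c0000⟩, ⟨0xf70004, 0xdb0000⟩, ⟨0x790008, 0xeb0000⟩,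
      ⟨0x7a0010, 0x9c0000⟩, ⟨0x4f0020, 0xeb0000⟩, ⟨0xc40040, 0xb10000⟩, ⟨0x940080, 0x5a0000⟩,
      ⟨0x450100, 0xdb0000⟩, ⟨0xad0200, 0x0⟩, ⟨0x5d0400, 0x950000⟩, ⟨0xf70800, 0x900000⟩,
      ⟨0x851000, 0x170000⟩, ⟨0x2f2000, 0x6e0000⟩, ⟨0x8f4000, 0x770000⟩, ⟨0x18000, 0x560000⟩]]
  multiplicity := 2
  bound := 3
  minWord := ⟨0x1c1, 0xe8⟩

def certificate_25_18_4 : Certificate 25 18 4 where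
  basis := ![
    ⟨0x1b80002, 0x1f00000⟩, ⟨0xdc0001, 0x1780002⟩, ⟨0x74000a, 0x380000⟩, ⟨0xfc0018, 0x1740003⟩,
    ⟨0x164001f, 0x2⟩, ⟨0xf00046, 0xa80012⟩, ⟨0x840077, 0x840009⟩, ⟨0x1f000e6, 0x170007d⟩,
    ⟨0x1d40253, 0x1bc00ea⟩, ⟨0x1cc10d2, 0x16800cc⟩, ⟨0xdc0195, 0x124107a⟩, ⟨0x8c312f, 0x14401ec⟩,
    ⟨0x942af1, 0x64129f⟩, ⟨0x1ac7fff, 0x6c20d7⟩, ⟨0xd437e2, 0x84e08⟩, ⟨0x1326821, 0x1ec1637⟩,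
    ⟨0x56c994, 0x19a7441⟩, ⟨0xd5561c, 0x8a2692⟩]
  informationSets := [
    List.zip [
      0, 1, 2, 3, 4, 5, 6, 7, 8, 9, 10, 11, 12, 13, 14, 15, 16, 17] [
      ⟨0x12c0001, 0x1300000⟩, ⟨0x1b80002, 0x1f00000⟩, ⟨0x3c0004, 0x1a80000⟩,
      ⟨0x1cc0008, 0x1c80000⟩, ⟨0x1f00010, 0xe80000⟩, ⟨0x1480020, 0xbc0000⟩,
      ⟨0x6c0040, 0x1a00000⟩, ⟨0x1f40080, 0x980000⟩, ⟨0x7c0100, 0x19c0000⟩,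
      ⟨0x1600200, 0x12c0000⟩, ⟨0x100400, 0xe40000⟩, ⟨0x19c0800, 0x4c0000⟩, ⟨0x1441000, 0x780000⟩,
      ⟨0x1e02000, 0x1980000⟩, ⟨0xfc4000, 0x580000⟩, ⟨0xa08000, 0x540000⟩, ⟨0x890000, 0x1080000⟩,
      ⟨0x15a0000, 0x1440000⟩]]
  multiplicity := 1
  bound := 3
  minWord := ⟨0x890000, 0x1080000⟩

def certificate_25_19_4 : Certificate 25 19 4 where
  basis := ![
    ⟨0x1580001, 0xa00000⟩, ⟨0x880002, 0x1f00000⟩, ⟨0x88000a, 0x3⟩, ⟨0x198000d, 0x1680000⟩,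
    ⟨0x500011, 0x68000e⟩, ⟨0x1080037, 0xd8000f⟩, ⟨0x28006d, 0x1200026⟩, ⟨0x601005, 0x188006d⟩,
    ⟨0xa00143, 0x981030⟩, ⟨0xb801d5, 0x1381031⟩, ⟨0x1001243, 0x110114a⟩, ⟨0xa82, 0x1a0008b⟩,
    ⟨0x1680fc5, 0x1d01284⟩, ⟨0x118519f, 0x1e80ae1⟩, ⟨0xa86897, 0x4848b6⟩, ⟨0x1340cf8, 0x1906e6d⟩,
    ⟨0x7cc650, 0x1e064bd⟩, ⟨0x1995a32, 0x5e1960⟩, ⟨0x97f43a, 0xfebba8⟩]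
  informationSets := [
    List.zip [
      0, 1, 2, 3, 4, 5, 6, 7, 8, 9, 10, 11, 12, 13, 14, 15, 16, 17, 18] [
      ⟨0x1580001, 0xa00000⟩, ⟨0x880002, 0x1f00000⟩, ⟨0x1900004, 0xb80000⟩,
      ⟨0x1500008, 0x1700000⟩, ⟨0x1300010, 0xb80000⟩, ⟨0xe00020, 0x0⟩, ⟨0x180040, 0xf80000⟩,
      ⟨0x900080, 0x1a80000⟩, ⟨0xb00100, 0x0⟩, ⟨0xe80200, 0x880000⟩, ⟨0xf00400, 0xd00000⟩,
      ⟨0x1780800, 0xe80000⟩, ⟨0x1381000, 0x1600000⟩, ⟨0x1002000, 0x780000⟩,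
      ⟨0x1b04000, 0x300000⟩, ⟨0x1c08000, 0x1580000⟩, ⟨0x910000, 0x1100000⟩,
      ⟨0x1aa0000, 0xd00000⟩, ⟨0x1dc0000, 0xe80000⟩]]
  multiplicity := 1
  bound := 3
  minWord := ⟨0xe00020, 0x0⟩

def certificate_26_16_6 : Certificate 26 16 6 where
  basis := ![
    ⟨0x1239, 0x3ba⟩, ⟨0x609, 0x12ea⟩, ⟨0xef1, 0x1192⟩, ⟨0x2456, 0x1d75⟩, ⟨0x47b7, 0x385d⟩,
    ⟨0x160c6, 0x500e⟩, ⟨0x1edef, 0x179a8⟩, ⟨0x448b3, 0x18ba9⟩, ⟨0x252d5, 0x4e7fb⟩,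
    ⟨0x2400e3, 0x70600⟩, ⟨0x11b8c3, 0x26c387⟩, ⟨0x19f787, 0x27a201⟩, ⟨0x701709, 0x15cea5⟩,
    ⟨0xec583d, 0x7abfc3⟩, ⟨0x234cad1, 0x32cfa5⟩, ⟨0x152be5d, 0x269496f⟩]
  informationSets := [
    List.zip [
      10, 11, 12, 13, 14, 15, 16, 17, 18, 19, 20, 21, 22, 23, 24, 25] [
      ⟨0x5b3, 0x369⟩, ⟨0x8f8, 0x378⟩, ⟨0x1239, 0x3ba⟩, ⟨0x224e, 0x2c5⟩, ⟨0x4003, 0x1bc⟩,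
      ⟨0x8294, 0x17a⟩, ⟨0x1008d, 0x34b⟩, ⟨0x20340, 0x239⟩, ⟨0x40101, 0x2c5⟩, ⟨0x8023e, 0x2d9⟩,
      ⟨0x10010b, 0x105⟩, ⟨0x20013c, 0x364⟩, ⟨0x4000e8, 0x310⟩, ⟨0x800191, 0x159⟩,
      ⟨0x10000ef, 0x75⟩, ⟨0x2000107, 0x9b⟩],
    List.zip [
      0, 1, 2, 3, 4, 5, 6, 7, 8, 9, 20, 21, 22, 23, 24, 25] [
      ⟨0xecc01, 0xcc800⟩, ⟨0x51002, 0x32000⟩, ⟨0x5f804, 0x98800⟩, ⟨0xe9808, 0xa1800⟩,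
      ⟨0x5a410, 0x5e800⟩, ⟨0x7e020, 0xe6400⟩, ⟨0xc1c40, 0x33000⟩, ⟨0xd2480, 0x70800⟩,
      ⟨0x7500, 0x48800⟩, ⟨0x8f600, 0xbc000⟩, ⟨0x14f800, 0xbf000⟩, ⟨0x22c400, 0x18400⟩,
      ⟨0x42e000, 0x7c000⟩, ⟨0x82b800, 0x7b800⟩, ⟨0x10b9800, 0xeb400⟩, ⟨0x2094000, 0x83c00⟩],
    List.zip [
      0, 1, 2, 3, 4, 5, 6, 7, 8, 9, 10, 11, 12, 13, 14, 15] [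
      ⟨0x2240001, 0x3440000⟩, ⟨0x32c0002, 0x1840000⟩, ⟨0x1c0004, 0x3d90000⟩,
      ⟨0x2660008, 0xe70000⟩, ⟨0x2d00010, 0x2c70000⟩, ⟨0x3180020, 0x2e10000⟩,
      ⟨0x3220040, 0x2a30000⟩, ⟨0x500080, 0x3760000⟩, ⟨0x820100, 0x3610000⟩,
      ⟨0x3cd0200, 0x3ea0000⟩, ⟨0x3780400, 0x2ac0000⟩, ⟨0x2350800, 0x3e0000⟩,
      ⟨0xff1000, 0x14a0000⟩, ⟨0x31b2000, 0x3d60000⟩, ⟨0x2074000, 0x2af0000⟩,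
      ⟨0x1d68000, 0x2270000⟩]]
  multiplicity := 2
  bound := 3
  minWord := ⟨0x10010b, 0x105⟩

def certificate_26_17_6 : Certificate 26 17 6 where
  basis := ![
    ⟨0x11b5, 0x159⟩, ⟨0x1336, 0x1f2⟩, ⟨0x158d, 0x1097⟩, ⟨0x1e38, 0x1f2⟩, ⟨0x52c0, 0x1115⟩,
    ⟨0x61e5, 0x1d39⟩, ⟨0x17fa9, 0x7448⟩, ⟨0x372ac, 0x20c0⟩, ⟨0xa189f, 0x35dde⟩,
    ⟨0xc40fc, 0x318b4⟩, ⟨0xfba49, 0xc16f3⟩, ⟨0x167d8f, 0x29e3ef⟩, ⟨0x330730, 0x250122⟩,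
    ⟨0x7e1c0b, 0x120e9a⟩, ⟨0xcaebc7, 0x23d5ab⟩, ⟨0x3eb2e8c, 0xcaabe7⟩, ⟨0x2792444, 0x37426c8⟩]
  informationSets := [
    List.zip [
      9, 10, 11, 12, 13, 14, 15, 16, 17, 18, 19, 20, 21, 22, 23, 24, 25] [
      ⟨0x283, 0xab⟩, ⟨0x561, 0x122⟩, ⟨0x86f, 0x122⟩, ⟨0x11b5, 0x159⟩, ⟨0x2013, 0xd0⟩,
      ⟨0x40af, 0xb⟩, ⟨0x80e5, 0x5c⟩, ⟨0x1018d, 0x1a9⟩, ⟨0x2007b, 0x83⟩, ⟨0x40044, 0x17e⟩,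
      ⟨0x80146, 0xbc⟩, ⟨0x1000a9, 0x1e2⟩, ⟨0x20017d, 0x27⟩, ⟨0x4001d7, 0x1d2⟩, ⟨0x8000b9, 0x7c⟩,
      ⟨0x10001b5, 0x9b⟩, ⟨0x2000090, 0x1c5⟩],
    List.zip [
      0, 1, 2, 3, 4, 5, 6, 7, 8, 18, 19, 20, 21, 22, 23, 24, 25] [
      ⟨0x8a01, 0x33e00⟩, ⟨0x28802, 0x25800⟩, ⟨0x22804, 0x37e00⟩, ⟨0x32a08, 0x27000⟩,
      ⟨0x21e10, 0x21a00⟩, ⟨0x31620, 0x30e00⟩, ⟨0x21e40, 0x37e00⟩, ⟨0x34080, 0x15800⟩,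
      ⟨0x38700, 0x35600⟩, ⟨0x65c00, 0x17000⟩, ⟨0x87a00, 0x30600⟩, ⟨0x13d000, 0x7800⟩,
      ⟨0x200e00, 0x12600⟩, ⟨0x41de00, 0x20e00⟩, ⟨0x828c00, 0x7200⟩, ⟨0x1033800, 0x37800⟩,
      ⟨0x2006e00, 0x20800⟩],
    List.zip [
      0, 1, 2, 3, 4, 5, 6, 7, 8, 9, 10, 11, 12, 13, 14, 15, 16] [
      ⟨0x380001, 0x27e0000⟩, ⟨0xd20002, 0x3940000⟩, ⟨0xb20004, 0xc80000⟩, ⟨0x39c0008, 0xa0000⟩,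
      ⟨0x1280010, 0x1b80000⟩, ⟨0x2b60020, 0x3080000⟩, ⟨0x1980040, 0x3060000⟩,
      ⟨0x1ce0080, 0x980000⟩, ⟨0x31a0100, 0x3ce0000⟩, ⟨0x3540200, 0x30c0000⟩,
      ⟨0x35e0400, 0x3920000⟩, ⟨0x3b80800, 0x30a0000⟩, ⟨0x2c41000, 0x5a0000⟩,
      ⟨0x3e42000, 0x30a0000⟩, ⟨0x15c4000, 0x2e0000⟩, ⟨0x168000, 0x3c20000⟩, ⟨0x3e90000, 0x60000⟩]]
  multiplicity := 2
  bound := 3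
  minWord := ⟨0x283, 0xab⟩

def certificate_26_20_4 : Certificate 26 20 4 where
  basis := ![
    ⟨0x3f00001, 0x1d00000⟩, ⟨0x3500009, 0x200000⟩, ⟨0x370000d, 0xf00001⟩, ⟨0x2b0000f, 0x600000⟩,
    ⟨0x2f00084, 0xc0000d⟩, ⟨0x50001e, 0x3a00086⟩, ⟨0x11c, 0x3f00016⟩, ⟨0x200129, 0x2700010⟩,
    ⟨0x101091, 0x10000ba⟩, ⟨0x601223, 0x1a010a6⟩, ⟨0xc01054, 0x33003bc⟩, ⟨0x3c0098c, 0x35013fb⟩,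
    ⟨0x2b02877, 0x2801044⟩, ⟨0xc03e70, 0x1603aff⟩, ⟨0x14085f4, 0x15a4⟩, ⟨0x1413005, 0x320a96d⟩,
    ⟨0x30431be, 0x1702205⟩, ⟨0x2a454a9, 0x3901249⟩, ⟨0x39927b8, 0x215ba29⟩, ⟨0x3a1200, 0x158fad6⟩]
  informationSets := [
    List.zip [
      0, 1, 2, 3, 4, 5, 6, 7, 8, 9, 10, 11, 12, 13, 14, 15, 16, 17, 18, 19] [
      ⟨0x3f00001, 0x1d00000⟩, ⟨0x100002, 0x2b00000⟩, ⟨0x1f00004, 0x2f00000⟩,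
      ⟨0xa00008, 0x1f00000⟩, ⟨0x3100010, 0x200000⟩, ⟨0x1700020, 0x3200000⟩,
      ⟨0x3a00040, 0x3700000⟩, ⟨0x1d00080, 0x2400000⟩, ⟨0x2200100, 0x2400000⟩,
      ⟨0x3400200, 0x2a00000⟩, ⟨0x1500400, 0x2d00000⟩, ⟨0x2900800, 0x2b00000⟩,
      ⟨0x3201000, 0x3b00000⟩, ⟨0x1c02000, 0x2900000⟩, ⟨0x3404000, 0x100000⟩,
      ⟨0x3608000, 0x1e00000⟩, ⟨0xa10000, 0x2400000⟩, ⟨0xa20000, 0x3700000⟩,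
      ⟨0x2240000, 0x1700000⟩, ⟨0x1380000, 0x500000⟩]]
  multiplicity := 1
  bound := 3
  minWord := ⟨0x2200100, 0x2400000⟩

def certificate_26_21_4 : Certificate 26 21 4 where
  basis := ![
    ⟨0x1600001, 0xa00000⟩, ⟨0x200009, 0x1800000⟩, ⟨0x40000b, 0x2000000⟩, ⟨0xe0001a, 0x3000003⟩,
    ⟨0x17, 0x1600001⟩, ⟨0x300002a, 0x3800001⟩, ⟨0x200006f, 0x1c00030⟩, ⟨0xa000d8, 0x280001e⟩,
    ⟨0x2e020a0, 0x68⟩, ⟨0xa021d9, 0x400085⟩, ⟨0x3c029b6, 0x3802152⟩, ⟨0x1e03863, 0x3e02025⟩,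
    ⟨0x603b2d, 0x2e01801⟩, ⟨0x260a12a, 0x601957⟩, ⟨0x3a0a528, 0x1e03ba3⟩, ⟨0x60fcac, 0x208d9a⟩,
    ⟨0x1414373, 0x3c0582c⟩, ⟨0x2e21449, 0x21d63b⟩, ⟨0x2f151e1, 0x3633b5d⟩, ⟨0x12fba77, 0xa338d0⟩,
    ⟨0x1ea1fd9, 0x2affaf7⟩]
  informationSets := [
    List.zip [
      0, 1, 2, 3, 4, 5, 6, 7, 8, 9, 10, 11, 12, 13, 14, 15, 16, 17, 18, 19, 20] [
      ⟨0x1600001, 0xa00000⟩, ⟨0x600002, 0x3800000⟩, ⟨0x3400004, 0x0⟩, ⟨0x1400008, 0x1200000⟩,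
      ⟨0x2e00010, 0x3800000⟩, ⟨0x2800020, 0xe00000⟩, ⟨0xe00040, 0x200000⟩,
      ⟨0x2c00080, 0x1a00000⟩, ⟨0x2000100, 0x1a00000⟩, ⟨0x1c00200, 0x2600000⟩,
      ⟨0x2a00400, 0x2800000⟩, ⟨0x1000800, 0x1c00000⟩, ⟨0x3001000, 0x2600000⟩,
      ⟨0x3402000, 0x3800000⟩, ⟨0x3604000, 0x2200000⟩, ⟨0x2008000, 0x2c00000⟩,
      ⟨0x210000, 0x3e00000⟩, ⟨0x3620000, 0x800000⟩, ⟨0x2c40000, 0x2800000⟩,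
      ⟨0x1a80000, 0x2200000⟩, ⟨0x3d00000, 0x2a00000⟩]]
  multiplicity := 1
  bound := 3
  minWord := ⟨0x3400004, 0x0⟩

def certificate_27_21_4 : Certificate 27 21 4 where
  basis := ![
    ⟨0xc00001, 0x2e00000⟩, ⟨0x6800011, 0x6e00000⟩, ⟨0x1a00013, 0x5a00011⟩,
    ⟨0x1e00015, 0x2400002⟩, ⟨0x6c0000d, 0x1000015⟩, ⟨0xe0005d, 0x2800014⟩,
    ⟨0x4a00073, 0x5c00014⟩, ⟨0x4400130, 0x1000073⟩, ⟨0xc0020f, 0x4200178⟩,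
    ⟨0x62001ae, 0x7200376⟩, ⟨0x6e00485, 0x260019b⟩, ⟨0x4e01267, 0x6e0024b⟩,
    ⟨0x26009b0, 0x7e01073⟩, ⟨0x38036a9, 0x7400c5d⟩, ⟨0x480af4a, 0x2995⟩, ⟨0x160f680, 0x5e014ee⟩,
    ⟨0x5c22a02, 0x460a6f1⟩, ⟨0x2c32488, 0x3a042f2⟩, ⟨0x4879625, 0x3a15f2c⟩,
    ⟨0x14c58ef, 0x4842f18⟩, ⟨0x256c1f2, 0x6c0ad9a⟩]
  informationSets := [
    List.zip [
      0, 1, 2, 3, 4, 5, 6, 7, 8, 9, 10, 11, 12, 13, 14, 15, 16, 17, 18, 19, 20] [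
      ⟨0xc00001, 0x2e00000⟩, ⟨0x1c00002, 0x3200000⟩, ⟨0x4400004, 0x6400000⟩,
      ⟨0x2e00008, 0x7c00000⟩, ⟨0x6400010, 0x4000000⟩, ⟨0x3200020, 0x5e00000⟩,
      ⟨0x2800040, 0x5a00000⟩, ⟨0x1a00080, 0x5200000⟩, ⟨0x4a00100, 0x3800000⟩,
      ⟨0x7600200, 0x5c00000⟩, ⟨0x7600400, 0x7e00000⟩, ⟨0x3000800, 0x6400000⟩,
      ⟨0x1001000, 0x4800000⟩, ⟨0x1402000, 0x1a00000⟩, ⟨0x6004000, 0x1000000⟩,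
      ⟨0x2208000, 0x3600000⟩, ⟨0x3610000, 0x4800000⟩, ⟨0x2420000, 0x3e00000⟩,
      ⟨0x3a40000, 0x4800000⟩, ⟨0x480000, 0x6000000⟩, ⟨0x1900000, 0x400000⟩]]
  multiplicity := 1
  bound := 3
  minWord := ⟨0x4400004, 0x6400000⟩

def certificate_27_22_4 : Certificate 27 22 4 where
  basis := ![
    ⟨0x2000004, 0x7800000⟩, ⟨0x4800005, 0x7400004⟩, ⟨0x5c00015, 0x5400004⟩,
    ⟨0x1800012, 0x4c00011⟩, ⟨0x3800020, 0x1c00014⟩, ⟨0x280003e, 0x4c00002⟩,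
    ⟨0x4408007, 0x3000013⟩, ⟨0x74000a1, 0x3008008⟩, ⟨0x80ff, 0x24000b6⟩, ⟨0x60081c0, 0x38080e6⟩,
    ⟨0x34082e6, 0x30081ad⟩, ⟨0x7800ac4, 0x18083e1⟩, ⟨0x7000c75, 0x6c00a60⟩,
    ⟨0x48189b9, 0x2808f47⟩, ⟨0x24119f8, 0x2c18ec3⟩, ⟨0x7c0d37e, 0x1157b⟩, ⟨0x280e6bd, 0x4809e12⟩,
    ⟨0x6497d65, 0x48108b2⟩, ⟨0x14ab89a, 0x749b6ab⟩, ⟨0x5c59d9c, 0x788745a⟩,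
    ⟨0x3483db, 0x3098b7d⟩, ⟨0x6a5332b, 0x2bab2f3⟩]
  informationSets := [
    List.zip [
      0, 1, 2, 3, 4, 5, 6, 7, 8, 9, 10, 11, 12, 13, 14, 15, 16, 17, 18, 19, 20, 21] [
      ⟨0x1000001, 0x5400000⟩, ⟨0x7800002, 0x1c00000⟩, ⟨0x2000004, 0x7800000⟩,
      ⟨0x1800008, 0x1c00000⟩, ⟨0x1400010, 0x2000000⟩, ⟨0x6000020, 0x7000000⟩,
      ⟨0x1800040, 0x5800000⟩, ⟨0xc00080, 0x6000000⟩, ⟨0x2800100, 0x6400000⟩,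
      ⟨0x2c00200, 0x5000000⟩, ⟨0x3800400, 0x3800000⟩, ⟨0x5c00800, 0x3000000⟩,
      ⟨0x7801000, 0x800000⟩, ⟨0x3402000, 0x3c00000⟩, ⟨0x4404000, 0x4800000⟩,
      ⟨0x6408000, 0x1400000⟩, ⟨0x6810000, 0x400000⟩, ⟨0x7c20000, 0x7c00000⟩,
      ⟨0xc40000, 0x2400000⟩, ⟨0x1880000, 0x7400000⟩, ⟨0x6100000, 0x5800000⟩,
      ⟨0x2600000, 0x7000000⟩]]
  multiplicity := 1
  bound := 3
  minWord := ⟨0x1000001, 0x5400000⟩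

def certificate_28_21_4 : Certificate 28 21 4 where
  basis := ![
    ⟨0x9400008, 0x7600000⟩, ⟨0xe00009, 0x9200000⟩, ⟨0x6a0000c, 0x2400000⟩,
    ⟨0x8400029, 0xfc00001⟩, ⟨0x8a000a8, 0x7000000⟩, ⟨0x7c000a2, 0xe800009⟩,
    ⟨0xf6000b8, 0x6c000a5⟩, ⟨0x66000cf, 0x2200090⟩, ⟨0xfc00177, 0xec00024⟩,
    ⟨0x1e00225, 0x5a00090⟩, ⟨0x208d, 0x640002c⟩, ⟨0xc802660, 0x3e0020b⟩, ⟨0x2c02ed0, 0x7602714⟩,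
    ⟨0x3204b20, 0x600772⟩, ⟨0x5401018, 0xf20679d⟩, ⟨0xce1352a, 0x5e0451c⟩,
    ⟨0xd21ad0d, 0x1203584⟩, ⟨0xda85953, 0x281a2fd⟩, ⟨0xf62adca, 0x9899259⟩,
    ⟨0x292bc87, 0x48ac2c8⟩, ⟨0x465cfd2, 0xfb29b88⟩]
  informationSets := [
    List.zip [
      0, 1, 2, 3, 4, 5, 6, 7, 8, 9, 10, 11, 12, 13, 14, 15, 16, 17, 18, 19, 20] [
      ⟨0x9a00001, 0xe400000⟩, ⟨0xf000002, 0x7200000⟩, ⟨0xfe00004, 0x5200000⟩,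
      ⟨0x9400008, 0x7600000⟩, ⟨0xcc00010, 0xd600000⟩, ⟨0x6e00020, 0x1000000⟩,
      ⟨0xd600040, 0xfa00000⟩, ⟨0x7000080, 0x1600000⟩, ⟨0x5e00100, 0xc600000⟩,
      ⟨0xd400200, 0x8000000⟩, ⟨0x7000400, 0x9c00000⟩, ⟨0x8a00800, 0x7200000⟩,
      ⟨0x9c01000, 0x800000⟩, ⟨0xb402000, 0x8200000⟩, ⟨0xc804000, 0xc800000⟩,
      ⟨0x408000, 0xde00000⟩, ⟨0xa210000, 0xba00000⟩, ⟨0x2a20000, 0x5200000⟩,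
      ⟨0xc040000, 0xd400000⟩, ⟨0xa680000, 0x5800000⟩, ⟨0x3700000, 0xd200000⟩]]
  multiplicity := 1
  bound := 3
  minWord := ⟨0xc804000, 0xc800000⟩

def certificate_28_22_4 : Certificate 28 22 4 where
  basis := ![
    ⟨0xf400001, 0x8c00000⟩, ⟨0x4c00009, 0xdc00000⟩, ⟨0x5000005, 0x3800008⟩,
    ⟨0x5800006, 0xac00008⟩, ⟨0x2400018, 0x7800008⟩, ⟨0xbc00023, 0x1c0001f⟩,
    ⟨0xf000064, 0xec00029⟩, ⟨0x13a, 0x9400047⟩, ⟨0x3000342, 0x3c00043⟩, ⟨0x1c00771, 0xb000253⟩,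
    ⟨0xc000299, 0x400055a⟩, ⟨0xec00aef, 0xe800252⟩, ⟨0x6c01e72, 0x64007b1⟩,
    ⟨0x1c09bbb, 0x78013e1⟩, ⟨0xec0a99c, 0x6408e60⟩, ⟨0x400cdf7, 0x4001c8b⟩,
    ⟨0x202a2fb, 0x8401ec8⟩, ⟨0x183e875, 0x3809453⟩, ⟨0x847c381, 0xbc08c46⟩,
    ⟨0xb8e6456, 0x146bee0⟩, ⟨0x1a4c779, 0x40d5be⟩, ⟨0x6f630e5, 0x30bb83e⟩]
  informationSets := [
    List.zip [
      0, 1, 2, 3, 4, 5, 6, 7, 8, 9, 10, 11, 12, 13, 14, 15, 16, 17, 18, 19, 20, 21] [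
      ⟨0xf400001, 0x8c00000⟩, ⟨0xfc00002, 0x1800000⟩, ⟨0xf400004, 0x5c00000⟩,
      ⟨0xb800008, 0x5000000⟩, ⟨0xcc00010, 0xc000000⟩, ⟨0xec00020, 0x5800000⟩,
      ⟨0x6c00040, 0xcc00000⟩, ⟨0x5c00080, 0x9800000⟩, ⟨0x6000100, 0xd000000⟩,
      ⟨0x9800200, 0x400000⟩, ⟨0xc000400, 0x1000000⟩, ⟨0xfc00800, 0xac00000⟩,
      ⟨0x3001000, 0x6800000⟩, ⟨0x2802000, 0x9c00000⟩, ⟨0xa004000, 0x3000000⟩,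
      ⟨0xd808000, 0x7000000⟩, ⟨0x5410000, 0x7000000⟩, ⟨0x3c20000, 0xac00000⟩,
      ⟨0x8040000, 0x2400000⟩, ⟨0x5c80000, 0xd400000⟩, ⟨0x9d00000, 0x5000000⟩,
      ⟨0x2600000, 0xf400000⟩]]
  multiplicity := 1
  bound := 3
  minWord := ⟨0xc000400, 0x1000000⟩

def certificate_28_23_4 : Certificate 28 23 4 where
  basis := ![
    ⟨0xc800002, 0xd800000⟩, ⟨0x5800001, 0xf000002⟩, ⟨0x7000012, 0xc000001⟩,
    ⟨0xf000014, 0xd000012⟩, ⟨0xd00001a, 0x9000011⟩, ⟨0x2000036, 0x2800007⟩,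
    ⟨0xc0000b1, 0x700003e⟩, ⟨0xb8000db, 0xb000085⟩, ⟨0x12a, 0x780009c⟩, ⟨0x400042e, 0x9800136⟩,
    ⟨0xe00409c, 0x18004e3⟩, ⟨0x6804712, 0xd0040fd⟩, ⟨0x18105ff, 0x38007ae⟩,
    ⟨0x70108af, 0x8810589⟩, ⟨0x3015081, 0x10044bf⟩, ⟨0x9845f59, 0xf005466⟩,
    ⟨0xc081f1b, 0x8119e2⟩, ⟨0x8093797, 0x40055bd⟩, ⟨0x7c85a13, 0xe01787b⟩,
    ⟨0x4d167e6, 0x2c40353⟩, ⟨0x5c5bdd6, 0x91c05a0⟩, ⟨0x2461af4, 0xf9573ae⟩,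
    ⟨0x120cfa3, 0xe44a5ef⟩]
  informationSets := [
    List.zip [
      0, 1, 2, 3, 4, 5, 6, 7, 8, 9, 10, 11, 12, 13, 14, 15, 16, 17, 18, 19, 20, 21, 22] [
      ⟨0x8000001, 0xe000000⟩, ⟨0xc800002, 0xd800000⟩, ⟨0x800004, 0x9800000⟩,
      ⟨0xd800008, 0x7000000⟩, ⟨0x5800010, 0x7800000⟩, ⟨0x1800020, 0xf000000⟩,
      ⟨0x4800040, 0xc800000⟩, ⟨0xb800080, 0xf800000⟩, ⟨0x6000100, 0x7800000⟩,
      ⟨0x2800200, 0x7000000⟩, ⟨0xf000400, 0x800000⟩, ⟨0xd000800, 0xa000000⟩,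
      ⟨0xc801000, 0x800000⟩, ⟨0x6002000, 0xf000000⟩, ⟨0x2004000, 0xd000000⟩,
      ⟨0xb808000, 0x9800000⟩, ⟨0x9810000, 0x1800000⟩, ⟨0xa820000, 0x6000000⟩,
      ⟨0xf840000, 0x8800000⟩, ⟨0x7880000, 0x8000000⟩, ⟨0x7900000, 0xe800000⟩,
      ⟨0x6200000, 0x800000⟩, ⟨0x9c00000, 0xe800000⟩]]
  multiplicity := 1
  bound := 3
  minWord := ⟨0x8000001, 0xe000000⟩

def certificate_29_22_4 : Certificate 29 22 4 where
  basis := ![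
    ⟨0x16000008, 0xec00000⟩, ⟨0x1d400200, 0x17400000⟩, ⟨0x19000201, 0x3800200⟩,
    ⟨0x1c000229, 0xd800208⟩, ⟨0x100002b, 0x18c00009⟩, ⟨0x1fc00263, 0x8400208⟩,
    ⟨0x300020c, 0xfc0006b⟩, ⟨0x6800073, 0xf00026d⟩, ⟨0x3000328, 0x680020c⟩,
    ⟨0x8c003c5, 0x1ec00307⟩, ⟨0xf800ab0, 0x480006c⟩, ⟨0x1d002119, 0x1b800006⟩,
    ⟨0x70005bb, 0x8c023e2⟩, ⟨0x100015fd, 0x1340ac50⟩, ⟨0x34052c1, 0x5008f5b⟩,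
    ⟨0x1bc25a7f, 0x1808f12⟩, ⟨0x1940b498, 0x1882a638⟩, ⟨0xb48dab7, 0xa02ac12⟩,
    ⟨0x34ce3e7, 0xe00a317⟩, ⟨0x1e9492ef, 0xc04028f⟩, ⟨0x1ac111a6, 0x172e292e⟩,
    ⟨0x36f3860, 0x12ee2ee4⟩]
  informationSets := [
    List.zip [
      0, 1, 2, 3, 4, 5, 6, 7, 8, 9, 10, 11, 12, 13, 14, 15, 16, 17, 18, 19, 20, 21] [
      ⟨0x13000001, 0x1ec00000⟩, ⟨0x9c00002, 0x5c00000⟩, ⟨0xb400004, 0x18400000⟩,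
      ⟨0x16000008, 0xec00000⟩, ⟨0x14400010, 0x19c00000⟩, ⟨0x1dc00020, 0x18000000⟩,
      ⟨0x1c000040, 0xec00000⟩, ⟨0x17400080, 0xd400000⟩, ⟨0x14400100, 0x6c00000⟩,
      ⟨0x1d400200, 0x17400000⟩, ⟨0x5000400, 0xc00000⟩, ⟨0xc400800, 0x3800000⟩,
      ⟨0x11801000, 0x15400000⟩, ⟨0x5802000, 0xb800000⟩, ⟨0x4404000, 0x1fc00000⟩,
      ⟨0x12c08000, 0x3800000⟩, ⟨0x6c10000, 0x1d400000⟩, ⟨0x420000, 0x1f000000⟩,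
      ⟨0x7040000, 0x1b800000⟩, ⟨0x1a480000, 0x13800000⟩, ⟨0x1a900000, 0x6800000⟩,
      ⟨0x9200000, 0x3400000⟩]]
  multiplicity := 1
  bound := 3
  minWord := ⟨0x9000002, 0x400⟩

def certificate_29_23_4 : Certificate 29 23 4 where
  basis := ![
    ⟨0x1b800001, 0x14000000⟩, ⟨0x1d000005, 0x9800001⟩, ⟨0x10800007, 0x1f800000⟩,
    ⟨0x800000b, 0x1000001⟩, ⟨0x580001f, 0x9800006⟩, ⟨0x1d000204, 0x780000f⟩,
    ⟨0x9000039, 0x1280020d⟩, ⟨0x11000067, 0xb80021f⟩, ⟨0x11800615, 0x4000037⟩,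
    ⟨0x1b0000e6, 0x6800671⟩, ⟨0x1c80444b, 0xb800044⟩, ⟨0x900012d, 0x19804648⟩,
    ⟨0x8810435, 0x580452c⟩, ⟨0x8014e05, 0x20106af⟩, ⟨0x1b81c491, 0x6014034⟩,
    ⟨0x1b01dd12, 0xd80cfb4⟩, ⟨0x503dc2e, 0x1580d9f8⟩, ⟨0x1400e0fd, 0xa825437⟩,
    ⟨0x178bc2cb, 0xf821098⟩, ⟨0x1785a1f9, 0x1089ebfa⟩, ⟨0x1643e817, 0xf81a9f0⟩,
    ⟨0x11f2807, 0x2cb7100⟩, ⟨0x17afbfbc, 0x1fc86697⟩]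
  informationSets := [
    List.zip [
      0, 1, 2, 3, 4, 5, 6, 7, 8, 9, 10, 11, 12, 13, 14, 15, 16, 17, 18, 19, 20, 21, 22] [
      ⟨0x1b800001, 0x14000000⟩, ⟨0x19800002, 0x19800000⟩, ⟨0x12800004, 0x12000000⟩,
      ⟨0x1e000008, 0x3000000⟩, ⟨0x800010, 0x15800000⟩, ⟨0xe800020, 0x16800000⟩,
      ⟨0x1800040, 0x11000000⟩, ⟨0xc800080, 0x9800000⟩, ⟨0x1000100, 0x15000000⟩,
      ⟨0x13000200, 0x7800000⟩, ⟨0x17800400, 0x12000000⟩, ⟨0xd800800, 0x17000000⟩,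
      ⟨0x13001000, 0x14800000⟩, ⟨0x1f802000, 0x13000000⟩, ⟨0x15804000, 0x16000000⟩,
      ⟨0x2808000, 0xa800000⟩, ⟨0xe810000, 0x5000000⟩, ⟨0x1c820000, 0x4800000⟩,
      ⟨0x1c040000, 0x8800000⟩, ⟨0x1f880000, 0x11800000⟩, ⟨0x3100000, 0x11000000⟩,
      ⟨0x9200000, 0x18800000⟩, ⟨0x14400000, 0x5800000⟩]]
  multiplicity := 1
  bound := 3
  minWord := ⟨0x12800004, 0x12000000⟩

def certificate_30_23_4 : Certificate 30 23 4 where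
  basis := ![
    ⟨0x11000001, 0x7000000⟩, ⟨0x24000002, 0xa800001⟩, ⟨0x30800008, 0x34800003⟩,
    ⟨0x1980000e, 0xc800003⟩, ⟨0x20800012, 0xd800005⟩, ⟨0x30000216, 0x11000014⟩,
    ⟨0x2d800236, 0x3f80021c⟩, ⟨0x2780026e, 0x1600021a⟩, ⟨0x210000cc, 0x36000218⟩,
    ⟨0x60001dd, 0x3c800239⟩, ⟨0xd8006e3, 0x1b800152⟩, ⟨0x180151f, 0x240000f5⟩,
    ⟨0x39001e45, 0x13800659⟩, ⟨0x320031d0, 0x8001df3⟩, ⟨0x16006dab, 0x2964⟩,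
    ⟨0x1820454, 0x33807851⟩, ⟨0x1402a21d, 0x2f001616⟩, ⟨0xe84052c, 0x26807a76⟩,
    ⟨0x1a83581c, 0x686ba49⟩, ⟨0x2289061d, 0x1583eaa9⟩, ⟨0x31262ca4, 0x14887846⟩,
    ⟨0x3b9e4858, 0x2e95ea⟩, ⟨0x1f4d65a5, 0x15bc0f2d⟩]
  informationSets := [
    List.zip [
      0, 1, 2, 3, 4, 5, 6, 7, 8, 9, 10, 11, 12, 13, 14, 15, 16, 17, 18, 19, 20, 21, 22] [
      ⟨0x11000001, 0x7000000⟩, ⟨0x23000002, 0x1c800000⟩, ⟨0xa000004, 0x24800000⟩,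
      ⟨0x2b000008, 0x1d000000⟩, ⟨0x20000010, 0x29800000⟩, ⟨0x27000020, 0xb000000⟩,
      ⟨0x39000040, 0xc000000⟩, ⟨0x2a000080, 0x2f800000⟩, ⟨0x1a000100, 0x1e000000⟩,
      ⟨0x34000200, 0x27800000⟩, ⟨0x18800400, 0x8000000⟩, ⟨0x35000800, 0x18000000⟩,
      ⟨0x12801000, 0x14000000⟩, ⟨0x9002000, 0xb800000⟩, ⟨0x12804000, 0x3b800000⟩,
      ⟨0x7808000, 0x19000000⟩, ⟨0x15010000, 0x13800000⟩, ⟨0x14820000, 0x10000000⟩,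
      ⟨0x7040000, 0x10000000⟩, ⟨0x20880000, 0x3e800000⟩, ⟨0x24900000, 0x33000000⟩,
      ⟨0x37a00000, 0x35000000⟩, ⟨0x16400000, 0x1d000000⟩]]
  multiplicity := 1
  bound := 3
  minWord := ⟨0x18800400, 0x8000000⟩

def certificate_30_24_4 : Certificate 30 24 4 where
  basis := ![
    ⟨0x22000002, 0x16000000⟩, ⟨0x34000001, 0xa000002⟩, ⟨0x33000009, 0x3b000001⟩,
    ⟨0x1f000007, 0x1f000009⟩, ⟨0x1d00040b, 0x1f00000a⟩, ⟨0x12000027, 0x600040f⟩,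
    ⟨0xc000031, 0x3000409⟩, ⟨0x33000522, 0x16000436⟩, ⟨0x7000469, 0x25000117⟩,
    ⟨0x3e000188, 0x16000560⟩, ⟨0x3e0006b3, 0x547⟩, ⟨0x2c0041b5, 0x35000640⟩,
    ⟨0x10000baa, 0x33004477⟩, ⟨0x50081ef, 0x6004b48⟩, ⟨0x1800a352, 0x3d000095⟩,
    ⟨0x240058f7, 0x2400a161⟩, ⟨0x1701be50, 0x14005c5b⟩, ⟨0x803e142, 0x1101bf21⟩,
    ⟨0x1608d0ce, 0xb018de4⟩, ⟨0xc0dbce3, 0x1b098f31⟩, ⟨0x61cfa37, 0x3a05e028⟩,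
    ⟨0x1c20f40f, 0x1f0a8956⟩, ⟨0x3ed924da, 0x3439a3b4⟩, ⟨0x25496c50, 0x35d81841⟩]
  informationSets := [
    List.zip [
      0, 1, 2, 3, 4, 5, 6, 7, 8, 9, 10, 11, 12, 13, 14, 15, 16, 17, 18, 19, 20, 21, 22, 23] [
      ⟨0x22000001, 0x3e000000⟩, ⟨0x22000002, 0x16000000⟩, ⟨0x38000004, 0x1d000000⟩,
      ⟨0x2f000008, 0x19000000⟩, ⟨0xf000010, 0x1f000000⟩, ⟨0x2a000020, 0x19000000⟩,
      ⟨0x21000040, 0x1b000000⟩, ⟨0xe000080, 0x30000000⟩, ⟨0x27000100, 0x16000000⟩,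
      ⟨0x3c000200, 0x25000000⟩, ⟨0x3d000400, 0x2c000000⟩, ⟨0x22000800, 0xf000000⟩,
      ⟨0x3d001000, 0x1b000000⟩, ⟨0x9002000, 0x20000000⟩, ⟨0x28004000, 0x4000000⟩,
      ⟨0xa008000, 0x2b000000⟩, ⟨0x2d010000, 0x4000000⟩, ⟨0x9020000, 0x3d000000⟩,
      ⟨0x35040000, 0x33000000⟩, ⟨0x26080000, 0x11000000⟩, ⟨0x38100000, 0x1b000000⟩,
      ⟨0x31200000, 0xe000000⟩, ⟨0x12400000, 0xa000000⟩, ⟨0x15800000, 0x1d000000⟩]]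
  multiplicity := 1
  bound := 3
  minWord := ⟨0x9002000, 0x20000000⟩

section Parameters

variable {n k d : ℕ}

theorem two_le_of_mem_paramSet (h : (n, k, d) ∈ paramSet) : 2 ≤ k := by
  simp only [paramSet, Set.mem_insert_iff, Set.mem_singleton_iff, Prod.mk.injEq] at h
  omega

theorem nonempty_certificate_of_mem_paramSet (h : (n, k, d) ∈ paramSet) :
    Nonempty (Certificate n k d) := by
  simp only [paramSet, Set.mem_insert_iff, Set.mem_singleton_iff, Prod.mk.injEq] at h
  obtain ⟨rfl, rfl, rfl⟩ | ⟨rfl, rfl, rfl⟩ | ⟨rfl, rfl, rfl⟩ | ⟨rfl, rfl, rfl⟩ | ⟨rfl, rfl, rfl⟩ |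
    ⟨rfl, rfl, rfl⟩ | ⟨rfl, rfl, rfl⟩ | ⟨rfl, rfl, rfl⟩ | ⟨rfl, rfl, rfl⟩ | ⟨rfl, rfl, rfl⟩ |
    ⟨rfl, rfl, rfl⟩ | ⟨rfl, rfl, rfl⟩ | ⟨rfl, rfl, rfl⟩ | ⟨rfl, rfl, rfl⟩ | ⟨rfl, rfl, rfl⟩ |
    ⟨rfl, rfl, rfl⟩ | ⟨rfl, rfl, rfl⟩ | ⟨rfl, rfl, rfl⟩ | ⟨rfl, rfl, rfl⟩ | ⟨rfl, rfl, rfl⟩ |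
    ⟨rfl, rfl, rfl⟩ := h
  exacts [⟨certificate_21_8_9⟩, ⟨certificate_21_10_8⟩, ⟨certificate_21_11_7⟩, ⟨certificate_22_8_10⟩,
    ⟨certificate_23_18_4⟩, ⟨certificate_24_16_6⟩, ⟨certificate_25_18_4⟩, ⟨certificate_25_19_4⟩,
    ⟨certificate_26_16_6⟩, ⟨certificate_26_17_6⟩, ⟨certificate_26_20_4⟩, ⟨certificate_26_21_4⟩,
    ⟨certificate_27_21_4⟩, ⟨certificate_27_22_4⟩, ⟨certificate_28_21_4⟩, ⟨certificate_28_22_4⟩,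
    ⟨certificate_28_23_4⟩, ⟨certificate_29_22_4⟩, ⟨certificate_29_23_4⟩, ⟨certificate_30_23_4⟩,
    ⟨certificate_30_24_4⟩]

end Parameters

end QuaternaryLCD

theorem mainTheorem7 {F : Type*} [Field F] [Fintype F] [DecidableEq F]
    (hF : Fintype.card F = 4) (n k d : ℕ) (h : (n, k, d) ∈ QuaternaryLCD.paramSet) (s : ℕ) :
    ∃ C : Submodule F (Fin (n + (4 ^ k - 1) / 3 * s) → F),
      QuaternaryLCD.IsCode (n + (4 ^ k - 1) / 3 * s) k (d + 4 ^ (k - 1) * s) C ∧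
      QuaternaryLCD.IsHermitianLCD 2 C := by
  obtain ⟨ω, hω⟩ := QuaternaryLCD.exists_isGenerator hF
  obtain ⟨c⟩ := QuaternaryLCD.nonempty_certificate_of_mem_paramSet h
  obtain ⟨C, hC, hLCD⟩ := c.exists_isHermitianLCD hω
  exact QuaternaryLCD.exists_isHermitianLCD_add_simplex hF
    (QuaternaryLCD.two_le_of_mem_paramSet h) hC hLCD s
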